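/- **Definitions.** Let $\mathbb F$ be a field. A polynomial $f\in\mathbb F[x_1,\dots,x_n]$ has *evaluation dimension at most* $r$ if for every subset $S=\{i_1,\dots,i_k\}\subseteq\{1,\dots,n\}$ $$\dim_{\mathbb F}\operatorname{span}\bigl\{f|_{x_{i_1}=\alpha_1,\dots,x_{i_k}=\alpha_k} : (\alpha_1,\dots,\alpha_k)\in\mathbb F^k\bigr\}\le r .$$ A *black-box algorithm* is a deterministic random access program, a fixed finite text not depending on the field, that gets the numbers $n,d,r$ as input and can access the polynomial $f$ only by querying values $f(a)$ at points $a\in\mathbb F^n$ of its choice. It has a memory of natural numbers (with addition, truncated subtraction and comparison) and a memory of field elements (with the field operations and zero test), with indirect addressing, and it can read the elements of $\mathbb F$ from an arbitrary given enumeration $e(0),e(1),\dots$ (a list of all elements without repetition, up to index $|\mathbb F|-1$, if $\mathbb F$ is finite; a sequence of pairwise distinct elements if $\mathbb F$ is infinite). Its running time is the number of executed instructions, where each assignment (of the value of an expression in the program text), query, test and transfer of control counts as one. **Theorem.** There are a black-box algorithm $P$ and a constant $c\in\mathbb N$ such that the following holds for every field $\mathbb F$, every enumeration of $\mathbb F$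 as above, and all integers $n,d,r\ge 0$ with $$|\mathbb F|\ \ge\ \bigl(2n(d+1)^7r^3\bigr)^2 .$$ If $f\in\mathbb F[x_1,\dots,x_n]$ has total degree at most $d$ and evaluation dimension at most $r$, then $P$, with input $n,d,r$ and black-box access to $f$, halts after at most $$(n+d+r+2)^{\,c\,(\lceil\log_2 n\rceil+1)}=\operatorname{poly}(n,d,r)^{O(1+\lg n)}$$ steps (with $\lceil\log_2 0\rceil:=0$), and outputs $1$ if $f$ is the zero polynomial and $0$ otherwise. -/

import Mathlib

namespace BlackBoxPIT

/-! ## Evaluation dimension -/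

/-- The partial evaluation of `f` in which every variable `x_i` with `i ∈ S` is replaced by the
scalar `α i`, and the other variables are kept. -/
noncomputable def partialEval {F : Type*} [Field F] {n : ℕ} (f : MvPolynomial (Fin n) F)
    (S : Finset (Fin n)) (α : S → F) : MvPolynomial (Fin n) F :=
  MvPolynomial.bind₁
    (fun i => if h : i ∈ S then MvPolynomial.C (α ⟨i, h⟩) else MvPolynomial.X i) f

/-- `f` has evaluation dimension at most `r`: for every set `S` of variables, the partial
evaluations of `f` on the variables in `S` span a space of dimension at most `r`. -/
def EvalDimLE {F : Type*} [Field F] {n : ℕ} (f : MvPolynomial (Fin n) F) (r : ℕ) : Prop :=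
  ∀ S : Finset (Fin n),
    Module.rank F (Submodule.span F (Set.range fun α : S → F => partialEval f S α)) ≤ r

/-! ## Random access machines over a field, with a black box

A machine has two memories, each an infinite array of cells addressed by natural numbers: one
holds natural numbers, the other holds elements of the field `F`. A program is a fixed finite text
which does not depend on the field. Numbers can only be added, subtracted (truncated at zero) and
compared, so that they have linearly many bits in the number of executed steps. Field
elements can be added, subtracted, multiplied, inverted, and tested for zero; as usual in
arithmetic models of computation these operations have unit cost. The elements of the field are
accessible through an enumeration `e : ℕ → F`. The input polynomial is accessible only through a
black box which evaluates it. -/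

/-- Expressions for natural numbers; `cell a` is the content of the cell of the number memory with
address `a` (indirect addressing is allowed). -/
inductive NExp : Type
  | const (k : ℕ)
  | cell (a : NExp)
  | add (a b : NExp)
  | sub (a b : NExp)

/-- Expressions for field elements; `cell a` is the content of the cell of the field memory with
address `a`, and `enum i` is the `i`-th element in the enumeration of the field. -/
inductive FExp : Type
  | zero
  | one
  | cell (a : NExp)
  | enum (i : NExp)
  | add (x y : FExp)
  | sub (x y : FExp)
  | mul (x y : FExp)
  | inv (x : FExp)

/-- Tests. -/
inductive Test : Type
  | lt (a b : NExp)
  | isZero (x : FExp)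
  | not (b : Test)
  | and (b c : Test)

/-- Programs. `setN a v` and `setF a x` write a value to the cell with address `a` of the number
memory, respectively of the field memory. `query a p` writes to the cell `a` of the field memory
the value of the black box at the point whose coordinates are in the cells `p, p + 1, …` of the
field memory. -/
inductive Prog : Type
  | nop
  | setN (a v : NExp)
  | setF (a : NExp) (x : FExp)
  | query (a p : NExp)
  | seq (P Q : Prog)
  | ite (b : Test) (P Q : Prog)
  | loop (b : Test) (P : Prog)

/-- The content of the two memories. -/
structure Mem (F : Type*) where
  num : ℕ → ℕ
  fld : ℕ → F

/-- The value of a numerical expression. -/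
def NExp.val {F : Type*} (m : Mem F) : NExp → ℕ
  | .const k => k
  | .cell a => m.num (a.val m)
  | .add a b => a.val m + b.val m
  | .sub a b => a.val m - b.val m

/-- The value of a field expression; the inverse of zero is zero. -/
def FExp.val {F : Type*} [Field F] (e : ℕ → F) (m : Mem F) : FExp → F
  | .zero => 0
  | .one => 1
  | .cell a => m.fld (a.val m)
  | .enum i => e (i.val m)
  | .add x y => x.val e m + y.val e m
  | .sub x y => x.val e m - y.val e m
  | .mul x y => x.val e m * y.val e m
  | .inv x => (x.val e m)⁻¹

/-- The truth of a test. -/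
def Test.Holds {F : Type*} [Field F] (e : ℕ → F) (m : Mem F) : Test → Prop
  | .lt a b => a.val m < b.val m
  | .isZero x => x.val e m = 0
  | .not b => ¬ b.Holds e m
  | .and b c => b.Holds e m ∧ c.Holds e m

/-- A configuration: the stack of the program parts that remain to be executed, and the memory.
The machine has halted when the stack is empty. -/
structure Config (F : Type*) where
  todo : List Prog
  mem : Mem F

open Classical in
/-- One step of a machine over the field `F`, with the enumeration `e` and the black box
`box : Fⁿ → F`. Every assignment, query, test and change of control is one step; the expressions
in a program have a bounded size, since the program is fixed. -/
noncomputable def step {F : Type*} [Field F] {n : ℕ} (e : ℕ → F) (box : (Fin n → F) → F) :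
    Config F → Config F
  | ⟨[], m⟩ => ⟨[], m⟩
  | ⟨.nop :: K, m⟩ => ⟨K, m⟩
  | ⟨.setN a v :: K, m⟩ => ⟨K, ⟨Function.update m.num (a.val m) (v.val m), m.fld⟩⟩
  | ⟨.setF a x :: K, m⟩ => ⟨K, ⟨m.num, Function.update m.fld (a.val m) (x.val e m)⟩⟩
  | ⟨.query a p :: K, m⟩ =>
      ⟨K, ⟨m.num, Function.update m.fld (a.val m) (box fun i => m.fld (p.val m + i))⟩⟩
  | ⟨.seq P Q :: K, m⟩ => ⟨P :: Q :: K, m⟩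
  | ⟨.ite b P Q :: K, m⟩ => if b.Holds e m then ⟨P :: K, m⟩ else ⟨Q :: K, m⟩
  | ⟨.loop b P :: K, m⟩ => if b.Holds e m then ⟨P :: .loop b P :: K, m⟩ else ⟨K, m⟩

/-- The start configuration: the numbers `n`, `d`, `r` are in the first three cells of the number
memory, and all other cells of both memories are zero. -/
def start {F : Type*} [Field F] (P : Prog) (n d r : ℕ) : Config F :=
  ⟨[P], ⟨fun i => if i = 0 then n else if i = 1 then d else if i = 2 then r else 0, fun _ => 0⟩⟩

/-- Started with the parameters `n`, `d`, `r` and with the `n`-variate polynomial `f` in the black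
box, the program `P` halts after at most `T` steps, and its output (the content of the cell `0` of
the number memory) is `1` if `f` is the zero polynomial and `0` if it is not. -/
def TestsZeroWithin {F : Type*} [Field F] (P : Prog) (e : ℕ → F) {n : ℕ} (d r : ℕ)
    (f : MvPolynomial (Fin n) F) (T : ℕ) : Prop :=
  ∃ t ≤ T, ∃ m : Mem F,
    (step e fun x : Fin n → F => MvPolynomial.eval x f)^[t] (start P n d r) = ⟨[], m⟩ ∧
      (f = 0 → m.num 0 = 1) ∧ (f ≠ 0 → m.num 0 = 0)

/-- `e` enumerates the field `F`: its terms are pairwise distinct as long as `F` has enough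
elements. So `e` lists each element exactly once up to the index `|F| - 1` if `F` is finite, and
is a sequence of pairwise distinct elements if `F` is infinite. -/
def IsEnumeration {F : Type*} (e : ℕ → F) : Prop :=
  Set.InjOn e {i : ℕ | (i : ℕ∞) < ENat.card F}

end BlackBoxPIT

/-! The program queries `f` on the whole image of a generator, so it suffices that every nonzero `f`
of the given class is nonzero somewhere on this image.

The generator merges variables in pairs. At each stage the coordinates are divided into blocks;
coordinate `i` runs along a polynomial curve of degree at most `r`, and all coordinates of a block
share one parameter. Initially the blocks are single coordinates and the curves are the identity. To
merge blocks `2b` and `2b + 1`, consider the partial evaluations of `f` on their coordinates as a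
function of the two parameters `(a, a')`. It is a polynomial of degree less than `D` in each, with
values in a space of dimension at most `r`. A rank condenser says that the `r` points `(α ω ^ l, (α
ω ^ l) ^ D)`, `l < r`, already give the whole span, for all but few `α`. So if `f` is nonzero for
some parameters, it remains nonzero for one of these `r` pairs, whatever the other coordinates are
(`block_condenser`). Interpolating the `r` points by new curves with nodes `e l` turns the choice of
`l` into one new parameter, and the degree of the curves does not grow. The bad `α` of a block do
not depend on the other blocks, so one `α` serves a whole level (`exists_level_seed`). After
`Nat.clog 2 n` levels a univariate polynomial of degree at most `d * r` remains (`exists_seed`).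

The condenser rests on a Vandermonde determinant. A space of univariate polynomials has a basis with
distinct orders `e i` of vanishing at `0`; the matrix of its values at `ω ^ l * X`, with `X ^ e i`
divided out of the columns, has at `0` a Vandermonde determinant in the `ω ^ e i` up to nonzero
factors (`exists_condenser`). Kronecker substitution and duality carry this over to vector-valued
bivariate polynomials (`exists_condenser_span`).

A seed consists of the indices of `ω` and `α` for each level and of the last parameter, that is, of
`2 * Nat.clog 2 n + 1` digits in a base polynomial in `n, d, r`. Trying all seeds gives the time
bound, which a small program logic (`Runs`, `Frame`) verifies. -/

namespace BlackBoxPIT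

/-! ## Rank condensers -/

section Condenser

open Polynomial

variable {F : Type*} [Field F]

/-- The determinant of the values at `ω ^ l * X` of polynomials with distinct orders of vanishing
at `0`, after division by the powers of `X`, does not vanish at `0`. -/
theorem eval_zero_det_ne_zero {m : ℕ} (q : Fin m → F[X]) (e : Fin m → ℕ) (ω : F)
    (hinj : Function.Injective fun i => ω ^ e i) (hq : ∀ i, (q i).eval 0 ≠ 0) :
    (Matrix.det (Matrix.of fun l i : Fin m =>
      C ((ω ^ (l : ℕ)) ^ e i) * (q i).comp (C (ω ^ (l : ℕ)) * X))).eval 0 ≠ 0 := by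
  rw [← coe_evalRingHom, RingHom.map_det]
  -- At `0` each composition collapses to `(q i).eval 0`, which leaves a transposed Vandermonde
  -- matrix with scaled columns.
  have : (evalRingHom (0 : F)).mapMatrix (Matrix.of fun l i : Fin m =>
      C ((ω ^ (l : ℕ)) ^ e i) * (q i).comp (C (ω ^ (l : ℕ)) * X)) =
      Matrix.of fun l i => (q i).eval 0 * (Matrix.vandermonde fun i => ω ^ e i).transpose l i := by
    ext l i
    simp [Matrix.vandermonde_apply, ← pow_mul, mul_comm]
  rw [this, Matrix.det_mul_row, Matrix.det_transpose]
  exact mul_ne_zero (Finset.prod_ne_zero_iff.2 fun i _ => hq i)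
    (Matrix.det_vandermonde_ne_zero_iff.2 hinj)

theorem natDegree_det_le_of_natDegree_le {m N : ℕ} (M : Matrix (Fin m) (Fin m) F[X])
    (hM : ∀ l i, (M l i).natDegree ≤ N) : M.det.natDegree ≤ m * N := by
  rw [Matrix.det_apply]
  refine natDegree_sum_le_of_forall_le _ _ fun σ _ => ?_
  refine (natDegree_smul_le _ _).trans ((natDegree_prod_le _ _).trans ?_)
  exact (Finset.sum_le_sum fun i _ => hM _ _).trans (by simp)

/-- A space of polynomials of dimension at most `r` and degrees less than `N` is embedded by
evaluation at `α, α ω, …, α ω ^ (r - 1)`, unless `α` is a root of a certain polynomial. -/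
theorem exists_condenser (P : Submodule F F[X]) {N r : ℕ}
    (hN : ∀ p ∈ P, p ∈ degreeLT F N) [FiniteDimensional F P] (hr : Module.finrank F P ≤ r)
    (ω : F) (hω : Set.InjOn (fun i : ℕ => ω ^ i) (Set.Iio N)) :
    ∃ Δ : F[X], Δ ≠ 0 ∧ Δ.natDegree ≤ r * N + 1 ∧ ∀ α, Δ.eval α ≠ 0 → ∀ p ∈ P,
      (∀ l < r, p.eval (α * ω ^ l) = 0) → p = 0 := by
  classical
  have hdeg : ∀ p ∈ P, p ≠ 0 → p.natDegree < N := fun p hp h0 => by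
    have := mem_degreeLT.1 (hN p hp)
    rwa [degree_eq_natDegree h0, Nat.cast_lt] at this
  -- The orders of vanishing at `0` that occur in `P`; one polynomial for each of them will form a
  -- basis.
  set E : Finset ℕ := (Finset.range N).filter fun e =>
    ∃ p ∈ P, p ≠ 0 ∧ p.natTrailingDegree = e with hE
  have hmemE : ∀ p ∈ P, p ≠ 0 → p.natTrailingDegree ∈ E := fun p hp h0 => by
    rw [hE, Finset.mem_filter, Finset.mem_range]
    exact ⟨(natTrailingDegree_le_natDegree p).trans_lt (hdeg p hp h0), p, hp, h0, rfl⟩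
  set m := E.card with hm
  set e : Fin m → ℕ := fun i => E.orderEmbOfFin hm.symm i with he
  have heE : ∀ i, e i ∈ E := fun i => Finset.orderEmbOfFin_mem _ _ _
  have heN : ∀ i, e i < N := fun i => Finset.mem_range.1 (Finset.mem_filter.1 (heE i)).1
  have hinj : Function.Injective fun i => ω ^ e i := fun i j hij =>
    (E.orderEmbOfFin hm.symm).injective (hω (heN i) (heN j) hij)
  have hex : ∀ i, ∃ p ∈ P, p ≠ 0 ∧ p.natTrailingDegree = e i := fun i =>
    (Finset.mem_filter.1 (heE i)).2
  choose p hpP hp0 hpe using hex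
  have hfac : ∀ i, ∃ q : F[X], p i = X ^ e i * q := fun i => by
    rw [← dvd_def, X_pow_dvd_iff]
    intro d hd
    exact coeff_eq_zero_of_lt_natTrailingDegree (by rwa [hpe i])
  choose q hpq using hfac
  have hq : ∀ i, (q i).eval 0 ≠ 0 := fun i => by
    have h1 : (p i).coeff (e i) ≠ 0 := by
      rw [← hpe i]
      exact trailingCoeff_nonzero_iff_nonzero.2 (hp0 i)
    rw [hpq i, mul_comm] at h1
    have h2 := coeff_mul_X_pow (q i) (e i) 0
    rw [zero_add] at h2
    rwa [h2, coeff_zero_eq_eval_zero] at h1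
  have hqdeg : ∀ i, (q i).natDegree ≤ N := fun i => by
    have h1 := hdeg _ (hpP i) (hp0 i)
    have h2 : q i ≠ 0 := fun h => hp0 i (by rw [hpq i, h, mul_zero])
    rw [hpq i, natDegree_mul (pow_ne_zero _ X_ne_zero) h2] at h1
    omega
  set M : Matrix (Fin m) (Fin m) F[X] := Matrix.of fun l i : Fin m =>
      C ((ω ^ (l : ℕ)) ^ e i) * (q i).comp (C (ω ^ (l : ℕ)) * X) with hM
  have hdet := eval_zero_det_ne_zero q e ω hinj hq
  rw [← hM] at hdet
  have hdet0 : M.det ≠ 0 := fun h => hdet (by rw [h, eval_zero])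
  -- The value of `p i` at `α ω ^ l` is `α ^ e i` times the entry of `M` at `α`, and this factor can
  -- be absorbed in the coefficients because `α ≠ 0`.
  have hkey : ∀ α : F, α ≠ 0 → M.det.eval α ≠ 0 → ∀ c : Fin m → F,
      (∀ l < m, (∑ i, c i • p i).eval (α * ω ^ l) = 0) → c = 0 := by
    intro α hα hΔ c hc
    have h1 : ((evalRingHom α).mapMatrix M).det ≠ 0 := by
      rwa [← RingHom.map_det, coe_evalRingHom]
    have h2 : ((evalRingHom α).mapMatrix M).mulVec (fun i => α ^ e i * c i) = 0 := by
      funext l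
      rw [Pi.zero_apply, ← hc l l.2, eval_finsetSum, Matrix.mulVec, dotProduct]
      refine Finset.sum_congr rfl fun i _ => ?_
      simp only [hM, RingHom.mapMatrix_apply, Matrix.map_apply, Matrix.of_apply, coe_evalRingHom,
        eval_mul, eval_C, eval_comp, eval_X, hpq i, eval_smul, eval_pow, smul_eq_mul,
        mul_comm (ω ^ (l : ℕ)) α]
      ring
    have h3 := Matrix.eq_zero_of_mulVec_eq_zero h1 h2
    ext i
    have := congrFun h3 i
    simpa [hα] using this
  -- Substituting `ω ^ l * X` in a relation shows that `M` annihilates the vector `X ^ e i * C (c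
  -- i)` over `F[X]`.
  have hlin : LinearIndependent F (fun i => (⟨p i, hpP i⟩ : P)) := by
    rw [Fintype.linearIndependent_iff]
    intro c hc
    have hc' : ∑ i, c i • p i = 0 := by
      simpa using congrArg (Submodule.subtype P) hc
    have hnz : (fun i => X ^ e i * C (c i) : Fin m → F[X]) = 0 := by
      refine Matrix.eq_zero_of_mulVec_eq_zero hdet0 ?_
      ext1 l
      have h4 := congrArg (fun s : F[X] => s.comp (C (ω ^ (l : ℕ)) * X)) hc'
      simp only [sum_comp, zero_comp] at h4
      rw [Pi.zero_apply, ← h4, Matrix.mulVec, dotProduct]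
      refine Finset.sum_congr rfl fun i _ => ?_
      simp only [hM, Matrix.of_apply, hpq i, smul_eq_C_mul, mul_comp, pow_comp, X_comp, C_comp,
        mul_pow, ← C_pow]
      ring
    intro i
    have := congrFun hnz i
    simpa using this
  -- Reading off the coefficients at the exponents in `E` is injective on `P`: the trailing
  -- coefficient of a nonzero element is among them.
  have hle : Module.finrank F P ≤ m := by
    let T : P →ₗ[F] (Fin m → F) := LinearMap.pi fun i => (lcoeff F (e i)).comp P.subtype
    have hT : Function.Injective T := by
      rw [← LinearMap.ker_eq_bot, LinearMap.ker_eq_bot']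
      intro x hx
      by_contra h0
      have hx0 : (x : F[X]) ≠ 0 := fun h => h0 (Subtype.ext h)
      have h5 := hmemE x x.2 hx0
      have : ∃ i, e i = (x : F[X]).natTrailingDegree := by
        have := Finset.range_orderEmbOfFin E hm.symm
        rw [← Finset.mem_coe, ← this] at h5
        exact h5
      obtain ⟨i, hi⟩ := this
      have h6 := congrFun hx i
      simp only [T, LinearMap.pi_apply, LinearMap.comp_apply, lcoeff_apply, Submodule.subtype_apply,
        Pi.zero_apply, hi] at h6
      exact trailingCoeff_nonzero_iff_nonzero.2 hx0 h6
    simpa using LinearMap.finrank_le_finrank_of_injective hT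
  have hcard : Fintype.card (Fin m) = Module.finrank F P :=
    le_antisymm hlin.fintype_card_le_finrank (by simpa using hle)
  have hspan := hlin.span_eq_top_of_card_eq_finrank' hcard
  rw [Fintype.card_fin] at hcard
  -- The factor `X` excludes `α = 0`.
  refine ⟨X * M.det, mul_ne_zero X_ne_zero hdet0, ?_, ?_⟩
  · have h7 : M.det.natDegree ≤ m * N := natDegree_det_le_of_natDegree_le M fun l i => by
      refine (natDegree_C_mul_le _ _).trans (natDegree_comp_le.trans ?_)
      calc _ ≤ N * 1 := Nat.mul_le_mul (hqdeg i) ((natDegree_C_mul_le _ _).trans natDegree_X_le)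
        _ = N := mul_one N
    refine (natDegree_mul_le).trans ?_
    rw [natDegree_X]
    have : m * N ≤ r * N := Nat.mul_le_mul_right _ (hcard ▸ hr)
    omega
  · intro α hα x hx hev
    rw [eval_mul, eval_X] at hα
    have hx' : (⟨x, hx⟩ : P) ∈ Submodule.span F (Set.range fun i => (⟨p i, hpP i⟩ : P)) := by
      rw [hspan]; trivial
    obtain ⟨c, hc⟩ := (Submodule.mem_span_range_iff_exists_fun F).1 hx'
    have hc' : ∑ i, c i • p i = x := by
      simpa using congrArg (Submodule.subtype P) hc
    have := hkey α (left_ne_zero_of_mul hα) (right_ne_zero_of_mul hα) c fun l hl => by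
      rw [hc']; exact hev l (hl.trans_le (hcard ▸ hr))
    rw [← hc', this]
    simp

end Condenser

/-! ### Condensing vector-valued polynomials, and elements with many distinct powers -/

section Span

open Polynomial

variable {F : Type*} [Field F]

theorem exists_le_eval_ne_zero {Δ : F[X]} (hΔ : Δ ≠ 0) {e : ℕ → F} {k : ℕ}
    (he : Set.InjOn e (Set.Iio (k + 1))) (hk : Δ.natDegree ≤ k) : ∃ i ≤ k, Δ.eval (e i) ≠ 0 := by
  by_contra! h
  refine hΔ (eq_zero_of_natDegree_lt_card_of_eval_eq_zero Δ (f := fun i : Fin (k + 1) => e i)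
    (fun i j hij => Fin.ext (he i.2 j.2 hij)) (fun i => h i (Nat.lt_succ_iff.1 i.2)) ?_)
  simpa using Nat.lt_succ_of_le hk

/-- A vector-valued bivariate polynomial whose values span a space of dimension at most `r` has
the same span on the `r` points `(α ω ^ l, (α ω ^ l) ^ D)`, unless `α` is a root of a certain
polynomial. -/
theorem exists_condenser_span {V : Type*} [AddCommGroup V] [Module F V] {D r : ℕ}
    (s : Finset (Fin 2 →₀ ℕ)) (c : (Fin 2 →₀ ℕ) → V) (hs : ∀ m ∈ s, m 0 < D ∧ m 1 < D)
    (g : F → F → V) (hg : ∀ a b, g a b = ∑ m ∈ s, (a ^ m 0 * b ^ m 1) • c m)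
    (U : Submodule F V) [FiniteDimensional F U] (hU : Module.finrank F U ≤ r)
    (hgU : ∀ a b, g a b ∈ U)
    (ω : F) (hω : Set.InjOn (fun i : ℕ => ω ^ i) (Set.Iio (D * D)))
    (e : ℕ → F) (he : Set.InjOn e (Set.Iio (D * D))) :
    ∃ Δ : F[X], Δ ≠ 0 ∧ Δ.natDegree ≤ r * (D * D) + 1 ∧ ∀ α, Δ.eval α ≠ 0 → ∀ a b,
      g a b ∈ Submodule.span F
        (Set.range fun l : Fin r => g (α * ω ^ (l : ℕ)) ((α * ω ^ (l : ℕ)) ^ D)) := by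
  classical
  -- Kronecker substitution: `m ↦ m 0 + D * m 1` reads the two exponents as digits in base `D`, so
  -- it is injective with values below `D * D`.
  have hexp : ∀ m ∈ s, m 0 + D * m 1 < D * D := fun m hm => by
    obtain ⟨h0, h1⟩ := hs m hm
    calc m 0 + D * m 1 < D + D * m 1 := by omega
      _ = D * (m 1 + 1) := by ring
      _ ≤ D * D := Nat.mul_le_mul_left _ h1
  have hexpinj : ∀ m ∈ s, ∀ m' ∈ s, m 0 + D * m 1 = m' 0 + D * m' 1 → m = m' := by
    intro m hm m' hm' h
    obtain ⟨h0, h1⟩ := hs m hm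
    obtain ⟨h0', h1'⟩ := hs m' hm'
    have e0 : m 0 = m' 0 := by
      have := congrArg (· % D) h
      simpa [Nat.add_mul_mod_self_left, Nat.mod_eq_of_lt h0, Nat.mod_eq_of_lt h0'] using this
    have e1 : m 1 = m' 1 := by
      rw [e0] at h
      exact Nat.eq_of_mul_eq_mul_left (by omega) (Nat.add_left_cancel h)
    ext i
    fin_cases i
    · exact e0
    · exact e1
  -- A functional `φ` is sent to the univariate polynomial `φ (g z (z ^ D))`, whose coefficients are
  -- the `φ (c m)`.
  let T : Module.Dual F V →ₗ[F] F[X] :=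
    ∑ m ∈ s, (monomial (m 0 + D * m 1)).comp (Module.Dual.eval F V (c m))
  have hT : ∀ φ, T φ = ∑ m ∈ s, monomial (m 0 + D * m 1) (φ (c m)) := fun φ => by
    simp [T, LinearMap.sum_apply, Module.Dual.eval_apply]
  have hTeval : ∀ φ z, (T φ).eval z = φ (g z (z ^ D)) := fun φ z => by
    rw [hT, hg, map_sum, eval_finsetSum]
    refine Finset.sum_congr rfl fun m _ => ?_
    rw [eval_monomial, map_smul, smul_eq_mul, mul_comm, pow_add, pow_mul]
  have hTdeg : ∀ φ, T φ ∈ degreeLT F (D * D) := fun φ => by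
    rw [hT]
    refine Submodule.sum_mem _ fun m hm => mem_degreeLT.2 ?_
    exact (degree_monomial_le _ _).trans_lt (Nat.cast_lt.2 (hexp m hm))
  have hTcoeff : ∀ φ, ∀ m ∈ s, (T φ).coeff (m 0 + D * m 1) = φ (c m) := fun φ m hm => by
    rw [hT, finsetSum_coeff, Finset.sum_eq_single m]
    · rw [coeff_monomial, if_pos rfl]
    · intro m' hm' hne
      rw [coeff_monomial, if_neg fun h => hne (hexpinj m' hm' m hm h)]
    · exact fun h => absurd hm h
  -- `T φ` depends only on the restriction of `φ` to `U`: the values of `T φ` are determined by it,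
  -- and a polynomial of degree below `D * D` is determined by its values at `D * D` points. So the
  -- range of `T` has dimension at most `r`.
  obtain ⟨S, hS⟩ := LinearMap.exists_rightInverse_of_surjective U.dualRestrict
    (LinearMap.range_eq_top.2 Subspace.dualRestrict_surjective)
  have hfac : ∀ φ, T φ = T (S (U.dualRestrict φ)) := fun φ => by
    have h1 : ∀ z, (T (φ - S (U.dualRestrict φ))).eval z = 0 := fun z => by
      have h2 := LinearMap.congr_fun (LinearMap.congr_fun hS (U.dualRestrict φ)) ⟨_, hgU z (z ^ D)⟩
      simp only [LinearMap.comp_apply, LinearMap.id_apply, Submodule.dualRestrict_apply] at h2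
      rw [hTeval, LinearMap.sub_apply, h2, sub_self]
    have h3 : T (φ - S (U.dualRestrict φ)) = 0 := by
      refine eq_zero_of_degree_lt_of_eval_index_eq_zero (s := Finset.range (D * D)) (v := e)
        (by simpa [Set.InjOn] using he) ?_ fun i _ => h1 _
      simpa using mem_degreeLT.1 (hTdeg (φ - S (U.dualRestrict φ)))
    rwa [map_sub, sub_eq_zero] at h3
  have hle : LinearMap.range T ≤ LinearMap.range (T.comp S) := by
    rintro _ ⟨φ, rfl⟩
    exact ⟨U.dualRestrict φ, (hfac φ).symm⟩
  have : FiniteDimensional F (LinearMap.range T) := Submodule.finiteDimensional_of_le hle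
  have hrank : Module.finrank F (LinearMap.range T) ≤ r :=
    (Submodule.finrank_mono hle).trans ((LinearMap.finrank_range_le _).trans
      (Subspace.dual_finrank_eq.trans_le hU))
  obtain ⟨Δ, h0, hdeg, hΔ⟩ := exists_condenser (LinearMap.range T)
    (by rintro _ ⟨φ, rfl⟩; exact hTdeg φ) hrank ω hω
  refine ⟨Δ, h0, hdeg, fun α hα a b => ?_⟩
  -- A functional that kills the span but not `g a b` gives a polynomial `T φ` vanishing at the `r`
  -- condenser points. So `T φ = 0`, all `φ (c m)` vanish, and so does `φ (g a b)`.
  by_contra hnot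
  obtain ⟨φ, hφ, hle'⟩ := Submodule.exists_le_ker_of_notMem hnot
  refine hφ ?_
  have hz := hΔ α hα (T φ) ⟨φ, rfl⟩ fun l hl => by
    rw [hTeval]
    exact hle' (Submodule.subset_span ⟨⟨l, hl⟩, rfl⟩)
  rw [hg, map_sum]
  refine Finset.sum_eq_zero fun m hm => ?_
  rw [map_smul, ← hTcoeff φ m hm, hz, coeff_zero, smul_zero]

/-- Powers of some element in a long list of distinct elements do not repeat soon. -/
theorem exists_pow_injOn {N : ℕ} {e : ℕ → F} (he : Set.InjOn e (Set.Iio (N * N + 2))) :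
    ∃ i ≤ N * N + 1, Set.InjOn (fun j : ℕ => e i ^ j) (Set.Iio N) := by
  have hne : ∀ k ∈ Finset.range N, (X ^ (k + 1) - 1 : F[X]) ≠ 0 := fun k _ =>
    X_pow_sub_C_ne_zero (Nat.succ_pos k) 1
  -- A non-root of this product is nonzero and has none of its powers with exponents `1, …, N` equal
  -- to `1`.
  have hdeg : (X * ∏ k ∈ Finset.range N, (X ^ (k + 1) - 1) : F[X]).natDegree ≤ N * N + 1 := by
    refine natDegree_mul_le.trans ?_
    rw [natDegree_X, add_comm]
    refine Nat.succ_le_succ ((natDegree_prod_le _ _).trans ?_)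
    refine (Finset.sum_le_card_nsmul _ _ N fun k hk => ?_).trans (by simp)
    have : (X ^ (k + 1) - 1 : F[X]).natDegree = k + 1 := natDegree_X_pow_sub_C (r := (1 : F))
    rw [this]
    exact Finset.mem_range.1 hk
  obtain ⟨i, hi, h⟩ := exists_le_eval_ne_zero
    (mul_ne_zero X_ne_zero (Finset.prod_ne_zero_iff.2 hne)) he hdeg
  refine ⟨i, hi, ?_⟩
  rw [eval_mul, eval_X, eval_prod] at h
  have h0 := left_ne_zero_of_mul h
  have h1 := Finset.prod_ne_zero_iff.1 (right_ne_zero_of_mul h)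
  have key : ∀ a b : ℕ, a < b → b < N → e i ^ a ≠ e i ^ b := by
    intro a b hab hb heq
    refine h1 (b - a - 1) (Finset.mem_range.2 (by omega)) ?_
    have hk : b - a - 1 + 1 = b - a := by omega
    have hb' : b = a + (b - a) := by omega
    rw [hk]
    rw [hb', pow_add] at heq
    have := mul_left_cancel₀ (pow_ne_zero a h0) ((mul_one _).trans heq)
    simp [← this]
  intro a ha b hb hab
  rcases lt_trichotomy a b with hlt | heq | hlt
  · exact absurd hab (key a b hlt hb)
  · exact heq
  · exact absurd hab.symm (key b a hlt ha)

end Span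

/-! ## The generator -/

section Generator

variable {F : Type*} [Field F]

/-- The value at `v` of the `j`-th Lagrange polynomial for the nodes `e 0, …, e r`. -/
noncomputable def lagrangeValue (e : ℕ → F) (r : ℕ) (v : F) (j : ℕ) : F :=
  ∏ b ∈ Finset.range (r + 1),
    open Classical in if e j - e b = 0 then 1 else (v - e b) * (e j - e b)⁻¹

/-- The value at `v` of the polynomial of degree at most `r` with the values `row 0, …, row r` at
the nodes `e 0, …, e r`. -/
noncomputable def interp (e : ℕ → F) (r : ℕ) (row : ℕ → F) (v : F) : F :=
  ∑ j ∈ Finset.range (r + 1), row j * lagrangeValue e r v j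

/-- The values at `r + 1` points, of the form `α ω ^ l` or `(α ω ^ l) ^ D` according to the
parity of `q`, of the curve given by `row`. -/
noncomputable def nextRow (e : ℕ → F) (r D : ℕ) (row : ℕ → F) (ω α : F) (q l : ℕ) : F :=
  interp e r row ((α * ω ^ l) ^ (if q % 2 = 0 then 1 else D))

/-- A coordinate of the generator with `K` levels; `q` is the number of the coordinate, and the
seed `t` is read in base `B`. -/
noncomputable def genCoord (e : ℕ → F) (r D B : ℕ) : ℕ → (ℕ → F) → ℕ → ℕ → F
  | 0, row, _, t => interp e r row (e t)
  | K + 1, row, q, t =>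
    genCoord e r D B K (nextRow e r D row (e (t % B)) (e (t / B % B)) q) (q / 2) (t / B / B)

theorem interp_congr {e : ℕ → F} {r : ℕ} {row row' : ℕ → F} (h : ∀ l < r + 1, row l = row' l)
    (v : F) : interp e r row v = interp e r row' v :=
  Finset.sum_congr rfl fun j hj => by rw [h j (Finset.mem_range.1 hj)]

/-- Only `r + 1` entries of a row matter, which is what allows the program to store rows in finitely
many cells. -/
theorem genCoord_congr {e : ℕ → F} {r D B : ℕ} {row row' : ℕ → F}
    (h : ∀ l < r + 1, row l = row' l) (K q t : ℕ) :
    genCoord e r D B K row q t = genCoord e r D B K row' q t := by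
  induction K generalizing row row' q t with
  | zero => exact interp_congr h _
  | succ K ih => exact ih (fun l _ => interp_congr h _) _ _

theorem interp_eq_eval {e : ℕ → F} {r : ℕ} (he : Set.InjOn e (Set.Iio (r + 1))) (row : ℕ → F)
    (v : F) :
    interp e r row v = (Lagrange.interpolate (Finset.range (r + 1)) e row).eval v := by
  rw [interp, Lagrange.interpolate_apply, Polynomial.eval_finsetSum]
  refine Finset.sum_congr rfl fun j hj => ?_
  rw [Polynomial.eval_mul, Polynomial.eval_C, Lagrange.basis, Polynomial.eval_prod, lagrangeValue,
    ← Finset.mul_prod_erase _ _ hj, if_pos (sub_self _), one_mul]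
  congr 1
  refine Finset.prod_congr rfl fun b hb => ?_
  obtain ⟨hne, hb⟩ := Finset.mem_erase.1 hb
  rw [if_neg fun h => hne (he (Finset.mem_range.1 hb) (Finset.mem_range.1 hj) (sub_eq_zero.1 h).symm),
    Lagrange.basisDivisor]
  simp [mul_comm]

theorem coe_range_eq_Iio (k : ℕ) : ((Finset.range k : Finset ℕ) : Set ℕ) = Set.Iio k := by
  ext; simp

theorem interp_node {e : ℕ → F} {r : ℕ} (he : Set.InjOn e (Set.Iio (r + 1))) (row : ℕ → F)
    {l : ℕ} (hl : l < r + 1) : interp e r row (e l) = row l := by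
  rw [interp_eq_eval he]
  exact Lagrange.eval_interpolate_at_node _ (by rwa [coe_range_eq_Iio]) (Finset.mem_range.2 hl)

theorem natDegree_interpolate_le {e : ℕ → F} {r : ℕ} (he : Set.InjOn e (Set.Iio (r + 1)))
    (row : ℕ → F) : (Lagrange.interpolate (Finset.range (r + 1)) e row).natDegree ≤ r := by
  have := Lagrange.degree_interpolate_le (s := Finset.range (r + 1)) (v := e) row
    (by rwa [coe_range_eq_Iio])
  exact Polynomial.natDegree_le_of_degree_le (by simpa using this)

/-- The row `e` represents the identity curve, with which the generator starts. This is why there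
are `r + 1` nodes and not `r`: for `r = 1` a single node would allow constants only. -/
theorem interp_self {e : ℕ → F} {r : ℕ} (hr : 1 ≤ r) (he : Set.InjOn e (Set.Iio (r + 1)))
    (v : F) : interp e r e v = v := by
  rw [interp_eq_eval he]
  have := Lagrange.eq_interpolate (s := Finset.range (r + 1)) (v := e)
    (f := (Polynomial.X : Polynomial F)) (by rwa [coe_range_eq_Iio])
    (by rw [Polynomial.degree_X, Finset.card_range]; exact_mod_cast Nat.lt_succ_of_le hr)
  simp only [Polynomial.eval_X] at this
  rw [← this, Polynomial.eval_X]

end Generator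

/-! ### Merging two blocks of variables, and one level of the generator -/

section Hitting

variable {F : Type*} [Field F] {n : ℕ}

open MvPolynomial

theorem totalDegree_aeval_le {σ τ R : Type*} [Fintype σ] [CommRing R] [Algebra F R]
    (f : MvPolynomial σ F) {d k : ℕ} (hf : f.totalDegree ≤ d) (u : σ → MvPolynomial τ R)
    (hu : ∀ i, (u i).totalDegree ≤ k) : (aeval u f).totalDegree ≤ d * k := by
  rw [aeval_def, eval₂_eq']
  refine totalDegree_finsetSum_le fun m hm => ?_
  refine (totalDegree_mul _ _).trans ?_
  rw [IsScalarTower.algebraMap_apply F R (MvPolynomial τ R), algebraMap_eq, totalDegree_C, zero_add]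
  refine (totalDegree_finsetProd _ _).trans ?_
  calc ∑ i, (u i ^ m i).totalDegree ≤ ∑ i, m i * k :=
        Finset.sum_le_sum fun i _ => (totalDegree_pow _ _).trans (Nat.mul_le_mul_left _ (hu i))
    _ = (∑ i, m i) * k := (Finset.sum_mul _ _ _).symm
    _ ≤ d * k := Nat.mul_le_mul_right _ ?_
  have := le_totalDegree hm
  rw [Finsupp.sum_fintype _ _ fun _ => rfl] at this
  exact this.trans hf

theorem totalDegree_polynomial_aeval_X_le {τ R : Type*} [CommRing R] [Algebra F R]
    (p : Polynomial F) (j : τ) :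
    (Polynomial.aeval (X j : MvPolynomial τ R) p).totalDegree ≤ p.natDegree := by
  rw [Polynomial.aeval_eq_sum_range]
  refine totalDegree_finsetSum_le fun k hk => ?_
  refine (totalDegree_smul_le _ _).trans ((totalDegree_pow _ _).trans ?_)
  have h1 : (X j : MvPolynomial τ R).totalDegree ≤ 1 := by
    rw [X]
    exact (totalDegree_monomial_le _ _).trans (by simp)
  calc _ ≤ k * 1 := Nat.mul_le_mul_left _ h1
    _ ≤ _ := by have := Finset.mem_range.1 hk; omega

theorem eval_partialEval (f : MvPolynomial (Fin n) F) (S : Finset (Fin n)) (β : S → F)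
    (x : Fin n → F) :
    eval x (partialEval f S β) = eval (fun i => if h : i ∈ S then β ⟨i, h⟩ else x i) f := by
  rw [partialEval, ← coe_aeval_eq_eval, ← coe_aeval_eq_eval]
  simp only [RingHom.coe_coe]
  rw [aeval_bind₁]
  congr 2
  ext i
  split_ifs <;> simp

/-- The partial evaluations on the coordinates of the blocks `2b` and `2b + 1` form a bivariate
polynomial in `(a, a')` with values in a space of dimension at most `r`, to which the condenser
applies. `Δ` is chosen before `x`, hence works for all values of the other coordinates. -/
theorem block_condenser {f : MvPolynomial (Fin n) F} {d r : ℕ} (hd : f.totalDegree ≤ d)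
    (hf : EvalDimLE f r) (p : Fin n → Polynomial F) (hp : ∀ i, (p i).natDegree ≤ r)
    {D : ℕ} (hD : d * r < D) (q : Fin n → ℕ) (b : ℕ)
    (ω : F) (hω : Set.InjOn (fun i : ℕ => ω ^ i) (Set.Iio (D * D)))
    (e : ℕ → F) (he : Set.InjOn e (Set.Iio (D * D))) :
    ∃ Δ : Polynomial F, Δ ≠ 0 ∧ Δ.natDegree ≤ r * (D * D) + 1 ∧ ∀ α, Δ.eval α ≠ 0 →
      ∀ (a a' : F) (x : Fin n → F), eval (fun i => if q i / 2 = b then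
        (p i).eval (if q i % 2 = 0 then a else a') else x i) f ≠ 0 →
      ∃ l < r, eval (fun i => if q i / 2 = b then
        (p i).eval (if q i % 2 = 0 then α * ω ^ l else (α * ω ^ l) ^ D) else x i) f ≠ 0 := by
  classical
  set S : Finset (Fin n) := Finset.univ.filter fun i => q i / 2 = b with hS
  have hmem : ∀ i, i ∈ S ↔ q i / 2 = b := fun i => by simp [hS]
  let U := Submodule.span F (Set.range fun β : S → F => partialEval f S β)
  let g : F → F → MvPolynomial (Fin n) F := fun a a' =>
    partialEval f S fun i => (p i).eval (if q i % 2 = 0 then a else a')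
  have hgeval : ∀ a a' x, eval x (g a a') = eval (fun i => if q i / 2 = b then
        (p i).eval (if q i % 2 = 0 then a else a') else x i) f := fun a a' x => by
    rw [eval_partialEval]
    refine congrArg (fun z => eval z f) (funext fun i => ?_)
    by_cases h : i ∈ S
    · rw [dif_pos h, if_pos ((hmem i).1 h)]
    · rw [dif_neg h, if_neg (h ∘ (hmem i).2)]
  -- The curves are substituted with two formal parameters, and the other variables become
  -- coefficients. The result `H` has degree at most `d * r < D`.
  let u : Fin n → MvPolynomial (Fin 2) (MvPolynomial (Fin n) F) := fun i =>
    if i ∈ S then Polynomial.aeval (X (if q i % 2 = 0 then 0 else 1)) (p i) else C (X i)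
  have hu : ∀ i, (u i).totalDegree ≤ r := fun i => by
    simp only [u]
    split_ifs
    · exact (totalDegree_polynomial_aeval_X_le _ _).trans (hp i)
    · exact (totalDegree_polynomial_aeval_X_le _ _).trans (hp i)
    · rw [totalDegree_C]; exact Nat.zero_le _
  set H := aeval u f with hH
  have hHdeg : H.totalDegree ≤ d * r := totalDegree_aeval_le f hd u hu
  have hHeval : ∀ a a', g a a' = eval ![C a, C a'] H := fun a a' => by
    have : ((aeval (R := MvPolynomial (Fin n) F) ![C a, C a']).restrictScalars F).comp (aeval u) =
        bind₁ fun i => if h : i ∈ S then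
          (C ((p i).eval (if q i % 2 = 0 then a else a')) : MvPolynomial (Fin n) F) else X i := by
      refine algHom_ext fun i => ?_
      simp only [AlgHom.comp_apply, aeval_X, bind₁_X_right, u]
      split_ifs
      · rw [← Polynomial.aeval_algHom_apply]
        simpa [algebraMap_eq] using
          Polynomial.aeval_algebraMap_apply (MvPolynomial (Fin n) F) a (p i)
      · rw [← Polynomial.aeval_algHom_apply]
        simpa [algebraMap_eq] using
          Polynomial.aeval_algebraMap_apply (MvPolynomial (Fin n) F) a' (p i)
      · simp
    have h2 := AlgHom.congr_fun this f
    rw [AlgHom.comp_apply] at h2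
    exact h2.symm
  have : FiniteDimensional F U :=
    Module.rank_lt_aleph0_iff.1 ((hf S).trans_lt (Cardinal.natCast_lt_aleph0))
  obtain ⟨Δ, h0, hdeg, hΔ⟩ := exists_condenser_span (D := D) (r := r) H.support (fun m => H.coeff m)
    (fun m hm => by
      have h1 : ∀ j, m j < D := fun j =>
        (((monomial_le_degreeOf j hm).trans (degreeOf_le_totalDegree _ _)).trans hHdeg).trans_lt hD
      exact ⟨h1 0, h1 1⟩)
    g (fun a a' => by
      rw [hHeval, eval_eq']
      refine Finset.sum_congr rfl fun m _ => ?_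
      rw [Fin.prod_univ_two, smul_eq_C_mul, mul_comm]
      simp)
    U (hU := by
      have := hf S
      exact Module.finrank_le_of_rank_le this)
    (fun a a' => Submodule.subset_span ⟨_, rfl⟩) ω hω e he
  refine ⟨Δ, h0, hdeg, fun α hα a a' x hne => ?_⟩
  by_contra! hall
  refine hne ?_
  rw [← hgeval]
  -- Evaluation at `x` is linear, so vanishing at the `r` condenser points forces vanishing on their
  -- span, which contains `g a a'`.
  have hle : Submodule.span F (Set.range fun l : Fin r =>
      g (α * ω ^ (l : ℕ)) ((α * ω ^ (l : ℕ)) ^ D)) ≤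
      LinearMap.ker (aeval (R := F) x).toLinearMap := by
    rw [Submodule.span_le]
    rintro _ ⟨l, rfl⟩
    have := hall l l.2
    rw [← hgeval] at this
    exact this
  exact hle (hΔ α hα a a')

/-- Substituting for no variable at all leaves `f`, so `f` itself lies in a space of dimension zero.
-/
theorem EvalDimLE.eq_zero {f : MvPolynomial (Fin n) F} (hf : EvalDimLE f 0) : f = 0 := by
  have h1 := hf ∅
  rw [Nat.cast_zero, nonpos_iff_eq_zero, rank_zero_iff] at h1
  have h3 : partialEval f ∅ (fun _ => 0) ∈
      Submodule.span F (Set.range fun α : (∅ : Finset (Fin n)) → F => partialEval f ∅ α) :=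
    Submodule.subset_span ⟨_, rfl⟩
  have h4 : partialEval f ∅ (fun _ => 0) = 0 :=
    congrArg Subtype.val (h1.elim (⟨_, h3⟩ : Submodule.span F (Set.range
      fun α : (∅ : Finset (Fin n)) → F => partialEval f ∅ α)) 0)
  simpa [partialEval] using h4

/-- One level of the generator. -/
theorem exists_level_seed {f : MvPolynomial (Fin n) F} {d r : ℕ} (hd : f.totalDegree ≤ d)
    (hf : EvalDimLE f r) (p : Fin n → Polynomial F) (hp : ∀ i, (p i).natDegree ≤ r)
    {D : ℕ} (hD : d * r < D) (q : Fin n → ℕ) (hq : ∀ i, q i < n)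
    (ω : F) (hω : Set.InjOn (fun i : ℕ => ω ^ i) (Set.Iio (D * D)))
    (e : ℕ → F) (he : Set.InjOn e (Set.Iio (D * D)))
    (he' : Set.InjOn e (Set.Iio (n * (r * (D * D) + 1) + 1)))
    (y : ℕ → F) (hy : eval (fun i => (p i).eval (y (q i))) f ≠ 0) :
    ∃ j ≤ n * (r * (D * D) + 1), ∃ l : ℕ → ℕ, (∀ b, l b < r) ∧
      eval (fun i => (p i).eval
        ((e j * ω ^ l (q i / 2)) ^ (if q i % 2 = 0 then 1 else D))) f ≠ 0 := by
  classical
  -- A non-root of the product of the `Δ b` is good for all blocks at once; there are at most `n` of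
  -- them.
  choose Δ h0 hdeg hΔ using fun b => block_condenser hd hf p hp hD q b ω hω e he
  obtain ⟨j, hj, hne⟩ := exists_le_eval_ne_zero (Δ := ∏ b ∈ Finset.range n, Δ b)
    (Finset.prod_ne_zero_iff.2 fun b _ => h0 b) he' <| by
      refine (Polynomial.natDegree_prod_le _ _).trans ?_
      exact (Finset.sum_le_card_nsmul _ _ _ fun b _ => hdeg b).trans (by simp)
  rw [Polynomial.eval_prod, Finset.prod_ne_zero_iff] at hne
  refine ⟨j, hj, ?_⟩
  set α := e j
  set z : ℕ → Fin n → F := fun l i => (α * ω ^ l) ^ (if q i % 2 = 0 then 1 else D) with hz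
  have hr : 0 < r := by
    refine Nat.pos_of_ne_zero fun h => hy ?_
    subst h
    rw [hf.eq_zero, map_zero]
  -- Hybrid argument: the merged blocks below `m` already have their new points, the others still
  -- have the parameters `y`. The passage from `m` to `m + 1` applies the condenser to block `m`
  -- alone.
  have key : ∀ m ≤ n, ∃ l : ℕ → ℕ, (∀ b, l b < r) ∧ eval (fun i => (p i).eval
      (if q i / 2 < m then z (l (q i / 2)) i else y (q i))) f ≠ 0 := by
    intro m
    induction m with
    | zero => exact fun _ => ⟨fun _ => 0, fun _ => hr, by simpa using hy⟩
    | succ m ih =>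
      intro hm
      obtain ⟨l, hl, hne'⟩ := ih (Nat.le_of_succ_le hm)
      have h1 : (fun i => (p i).eval (if q i / 2 < m then z (l (q i / 2)) i else y (q i))) =
          fun i => if q i / 2 = m then
            (p i).eval (if q i % 2 = 0 then y (2 * m) else y (2 * m + 1)) else
            (p i).eval (if q i / 2 < m then z (l (q i / 2)) i else y (q i)) := by
        ext i
        split_ifs with h2 h3 h4 h5
        · omega
        · omega
        · rfl
        · rw [show q i = 2 * m by omega]
        · rw [show q i = 2 * m + 1 by omega]
        · rfl
      rw [h1] at hne'
      obtain ⟨k, hk, hne''⟩ := hΔ m α (hne m (Finset.mem_range.2 hm)) _ _ _ hne'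
      refine ⟨Function.update l m k, fun b => ?_, ?_⟩
      · rcases eq_or_ne b m with rfl | hb
        · rwa [Function.update_self]
        · rw [Function.update_of_ne hb]; exact hl b
      · convert hne'' using 3
        ext i
        rcases lt_trichotomy (q i / 2) m with h2 | h2 | h2
        · rw [if_pos (Nat.lt_succ_of_lt h2), if_neg h2.ne, if_pos h2, Function.update_of_ne h2.ne]
        · rw [if_pos (by omega), if_pos h2, h2, Function.update_self]
          simp only [hz]
          split_ifs <;> simp
        · rw [if_neg (by omega), if_neg h2.ne', if_neg (by omega)]
  obtain ⟨l, hl, hne'⟩ := key n le_rfl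
  refine ⟨l, hl, ?_⟩
  convert hne' using 3
  ext i
  rw [if_pos (lt_of_le_of_lt (Nat.div_le_self _ _) (hq i))]

end Hitting

/-! ### Existence of a good seed -/

section Seed

variable {F : Type*} [Field F] {n : ℕ}

open MvPolynomial

/-- Induction on the number of levels. The rows and block numbers are general because each level
changes both; `q i < 2 ^ K` ensures that a single block remains at the end. -/
theorem exists_seed {f : MvPolynomial (Fin n) F} {d r D M B : ℕ} (hd : f.totalDegree ≤ d)
    (hf : EvalDimLE f r) (hD : d * r < D) {e : ℕ → F} (he : Set.InjOn e (Set.Iio M))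
    (h1 : D * D * (D * D) + 2 ≤ M) (h2 : n * (r * (D * D) + 1) + 1 ≤ M) (h3 : r + 1 ≤ M)
    (hB : M ≤ B) (K : ℕ) (row : Fin n → ℕ → F) (q : Fin n → ℕ) (hq : ∀ i, q i < n)
    (hqK : ∀ i, q i < 2 ^ K) (y : ℕ → F)
    (hy : eval (fun i => interp e r (row i) (y (q i))) f ≠ 0) :
    ∃ t < B ^ (2 * K + 1), eval (fun i => genCoord e r D B K (row i) (q i) t) f ≠ 0 := by
  have mono : ∀ {a}, a ≤ M → Set.InjOn e (Set.Iio a) := fun h =>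
    he.mono (Set.Iio_subset_Iio h)
  have her := mono h3
  have hDD : D * D ≤ D * D * (D * D) := Nat.le_mul_self _
  induction K generalizing row q y with
  | zero =>
    -- All coordinates share one parameter now, so `f` along the curves is a nonzero univariate
    -- polynomial of degree at most `d * r`.
    have hq0 : ∀ i, q i = 0 := fun i => by simpa using hqK i
    set p : Fin n → Polynomial F := fun i =>
      Lagrange.interpolate (Finset.range (r + 1)) e (row i)
    set Q : Polynomial F := aeval p f
    have hQ : ∀ z, Q.eval z = eval (fun i => interp e r (row i) z) f := fun z => by
      simp only [interp_eq_eval her]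
      have h : ((Polynomial.aeval z).comp (aeval p) : MvPolynomial (Fin n) F →ₐ[F] F) =
          aeval fun i => (p i).eval z := by
        ext i; simp
      exact (AlgHom.congr_fun h f :)
    have hQ0 : Q ≠ 0 := fun h => hy (by
      simp only [hq0]
      rw [← hQ, h, Polynomial.eval_zero])
    have hQdeg : Q.natDegree ≤ d * r :=
      aeval_natDegree_le f hd p fun i => natDegree_interpolate_le her _
    have hle : d * r + 1 ≤ M := by nlinarith
    obtain ⟨t, ht, hne⟩ := exists_le_eval_ne_zero hQ0 (mono hle) hQdeg
    rw [hQ] at hne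
    exact ⟨t, by simp; omega, hne⟩
  | succ K ih =>
    obtain ⟨i₀, hi₀, hω⟩ := exists_pow_injOn (N := D * D) (mono h1)
    set p : Fin n → Polynomial F := fun i =>
      Lagrange.interpolate (Finset.range (r + 1)) e (row i)
    obtain ⟨j, hj, l, hl, hne⟩ := exists_level_seed hd hf p
      (fun i => natDegree_interpolate_le her _) hD q hq (e i₀) hω e (mono (by omega)) (mono h2) y
      (by simpa only [interp_eq_eval her] using hy)
    -- The new parameter of block `b` is the node `e (l b)`, where the interpolating curves pass
    -- through the chosen point. Since the new curves are interpolations and not compositions, their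
    -- degree is again at most `r`.
    obtain ⟨t, ht, ht'⟩ := ih (fun i => nextRow e r D (row i) (e i₀) (e j) (q i))
      (fun i => q i / 2) (fun i => (Nat.div_le_self _ _).trans_lt (hq i))
      (fun i => Nat.div_lt_of_lt_mul (by rw [← pow_succ']; exact hqK i)) (fun b => e (l b)) (by
        simp only [interp_node her _ ((hl _).trans (Nat.lt_succ_self r)), nextRow,
          interp_eq_eval her]
        exact hne)
    have hi₀B : i₀ < B := by omega
    have hjB : j < B := by omega
    -- The two lowest digits are the indices of `ω` and `α`; the rest is the seed for the remaining
    -- levels.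
    refine ⟨i₀ + B * (j + B * t), ?_, ?_⟩
    · have h4 : j + B * t < B * B ^ (2 * K + 1) := by
        calc j + B * t < B * (t + 1) := by rw [mul_add]; omega
          _ ≤ _ := Nat.mul_le_mul_left _ ht
      calc i₀ + B * (j + B * t) < B * (j + B * t + 1) := by rw [mul_add B (j + B * t)]; omega
        _ ≤ B * (B * B ^ (2 * K + 1)) := Nat.mul_le_mul_left _ h4
        _ = B ^ (2 * (K + 1) + 1) := by ring
    · have e1 : (i₀ + B * (j + B * t)) % B = i₀ := by
        rw [Nat.add_mul_mod_self_left, Nat.mod_eq_of_lt hi₀B]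
      have e2 : (i₀ + B * (j + B * t)) / B = j + B * t := by
        rw [Nat.add_mul_div_left _ _ (by omega), Nat.div_eq_of_lt hi₀B, zero_add]
      have e3 : (j + B * t) % B = j := by
        rw [Nat.add_mul_mod_self_left, Nat.mod_eq_of_lt hjB]
      have e4 : (j + B * t) / B = t := by
        rw [Nat.add_mul_div_left _ _ (by omega), Nat.div_eq_of_lt hjB, zero_add]
      simp only [genCoord, e1, e2, e3, e4]
      exact ht'

/-- The generator hits all nonzero polynomials of low degree and low evaluation dimension. -/
theorem exists_genCoord_ne_zero {e : ℕ → F} (he : IsEnumeration e) {d r : ℕ}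
    (hF : (((2 * n * (d + 1) ^ 7 * r ^ 3) ^ 2 : ℕ) : ℕ∞) ≤ ENat.card F)
    {f : MvPolynomial (Fin n) F} (hd : f.totalDegree ≤ d) (hf : EvalDimLE f r) (h0 : f ≠ 0) :
    ∃ t < ((n + d + r + 2) ^ 24) ^ (2 * Nat.clog 2 n + 1),
      eval (fun i : Fin n => genCoord e r ((d + 1) * r) ((n + d + r + 2) ^ 24) (Nat.clog 2 n) e i t)
        f ≠ 0 := by
  -- For `n = 0` the bound on `|F|` is void, but then `f` is a constant.
  rcases Nat.eq_zero_or_pos n with rfl | hn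
  · refine ⟨0, by positivity, ?_⟩
    rw [eq_C_of_isEmpty f, eval_C]
    intro h
    rw [eq_C_of_isEmpty f, h, C_0] at h0
    exact h0 rfl
  have hr : 1 ≤ r := by
    by_contra h
    have hr0 : r = 0 := by omega
    subst hr0
    exact h0 hf.eq_zero
  set M := (2 * n * (d + 1) ^ 7 * r ^ 3) ^ 2 with hM
  have heM : Set.InjOn e (Set.Iio M) := he.mono fun i hi =>
    lt_of_lt_of_le (Nat.cast_lt.2 hi) hF
  have hpos : 1 ≤ (d + 1) ^ 14 * r ^ 6 := Nat.succ_le_of_lt (by positivity)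
  have hMeq : M = 4 * n ^ 2 * ((d + 1) ^ 14 * r ^ 6) := by rw [hM]; ring
  have hn2 : n ≤ n ^ 2 := by nlinarith
  have hM2 : 4 * n * ((d + 1) ^ 14 * r ^ 6) ≤ M := by
    rw [hMeq]; gcongr
  have hM4 : 4 * ((d + 1) ^ 14 * r ^ 6) ≤ M := by nlinarith
  have hd1 : 1 ≤ d + 1 := by omega
  have h1 : (d + 1) * r * ((d + 1) * r) * ((d + 1) * r * ((d + 1) * r)) + 2 ≤ M := by
    have : (d + 1) * r * ((d + 1) * r) * ((d + 1) * r * ((d + 1) * r)) = (d + 1) ^ 4 * r ^ 4 := by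
      ring
    rw [this]
    have : (d + 1) ^ 4 * r ^ 4 ≤ (d + 1) ^ 14 * r ^ 6 := by gcongr <;> omega
    omega
  have h2' : r * ((d + 1) * r * ((d + 1) * r)) ≤ (d + 1) ^ 14 * r ^ 6 := by
    calc r * ((d + 1) * r * ((d + 1) * r)) = (d + 1) ^ 2 * r ^ 3 := by ring
      _ ≤ _ := by gcongr <;> omega
  have h2 : n * (r * ((d + 1) * r * ((d + 1) * r)) + 1) + 1 ≤ M := by
    refine le_trans ?_ hM2
    calc n * (r * ((d + 1) * r * ((d + 1) * r)) + 1) + 1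
        ≤ n * ((d + 1) ^ 14 * r ^ 6 + 1) + 1 := by gcongr
      _ ≤ _ := by nlinarith
  have h3 : r + 1 ≤ M := by
    have : r ≤ r ^ 6 := Nat.le_self_pow (by omega) r
    have : 1 * r ^ 6 ≤ (d + 1) ^ 14 * r ^ 6 := Nat.mul_le_mul_right _ (Nat.one_le_pow _ _ hd1)
    omega
  have hdM : d + 1 ≤ M := by
    have : d + 1 ≤ (d + 1) ^ 14 := Nat.le_self_pow (by omega) (d + 1)
    have : (d + 1) ^ 14 * 1 ≤ (d + 1) ^ 14 * r ^ 6 := Nat.mul_le_mul_left _ (Nat.one_le_pow _ _ hr)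
    omega
  -- The exponent is `2 + 2 + 14 + 6`, for the factors `4`, `n ^ 2`, `(d + 1) ^ 14` and `r ^ 6` of
  -- `M`.
  have hB : M ≤ (n + d + r + 2) ^ 24 := by
    rw [hMeq]
    have key : ∀ X, 2 ≤ X → n ≤ X → d + 1 ≤ X → r ≤ X →
        4 * n ^ 2 * ((d + 1) ^ 14 * r ^ 6) ≤ X ^ 24 := fun X hX hnX hdX hrX => by
      calc 4 * n ^ 2 * ((d + 1) ^ 14 * r ^ 6) = 2 ^ 2 * n ^ 2 * ((d + 1) ^ 14 * r ^ 6) := by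
            norm_num
        _ ≤ X ^ 2 * X ^ 2 * (X ^ 14 * X ^ 6) := by gcongr
        _ = X ^ 24 := by rw [← pow_add, ← pow_add, ← pow_add]
    exact key _ (by omega) (by omega) (by omega) (by omega)
  -- A nonzero polynomial of degree at most `d` does not vanish on a grid with `d + 1` values for
  -- each variable.
  have hexy : ∃ y : Fin n → F, eval y f ≠ 0 := by
    classical
    by_contra! hall
    refine h0 (eq_zero_of_eval_zero_at_prod_finset f
      (fun _ => (Finset.range (d + 1)).image e) (fun i => ?_) fun x _ => hall x)
    rw [Finset.card_image_of_injOn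
      (by rw [coe_range_eq_Iio]; exact heM.mono (Set.Iio_subset_Iio hdM)), Finset.card_range]
    exact Nat.lt_succ_of_le ((degreeOf_le_totalDegree _ _).trans hd)
  obtain ⟨y, hy⟩ := hexy
  -- `D = (d + 1) * r` exceeds `d * r` because `r ≥ 1`. Initially every coordinate is its own block
  -- and moves along the identity curve.
  refine exists_seed hd hf (by rw [add_mul]; omega) heM h1 h2 h3 hB _ (fun _ => e) (fun i => i)
    (fun i => i.2) (fun i => i.2.trans_le (Nat.le_pow_clog one_lt_two n))
    (fun j => if h : j < n then y ⟨j, h⟩ else 0) ?_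
  have her : Set.InjOn e (Set.Iio (r + 1)) := heM.mono (Set.Iio_subset_Iio h3)
  simpa [interp_self hr her] using hy

end Seed

/-! ## Program logic -/

section Logic

variable {F : Type*}

/-- Overwriting one number cell. -/
def Mem.setNum (m : Mem F) (a v : ℕ) : Mem F := ⟨Function.update m.num a v, m.fld⟩

/-- Overwriting one field cell. -/
def Mem.setFld (m : Mem F) (a : ℕ) (x : F) : Mem F := ⟨m.num, Function.update m.fld a x⟩

@[simp] theorem Mem.setNum_fld (m : Mem F) (a v : ℕ) : (m.setNum a v).fld = m.fld := rfl

@[simp] theorem Mem.setFld_num (m : Mem F) (a : ℕ) (x : F) : (m.setFld a x).num = m.num := rfl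

@[simp] theorem Mem.setNum_num_self (m : Mem F) (a v : ℕ) : (m.setNum a v).num a = v :=
  Function.update_self ..

@[simp] theorem Mem.setFld_fld_self (m : Mem F) (a : ℕ) (x : F) : (m.setFld a x).fld a = x :=
  Function.update_self ..

theorem Mem.setNum_num_of_ne (m : Mem F) {a c : ℕ} (v : ℕ) (h : c ≠ a) :
    (m.setNum a v).num c = m.num c :=
  Function.update_of_ne h ..

theorem Mem.setFld_fld_of_ne (m : Mem F) {a c : ℕ} (x : F) (h : c ≠ a) :
    (m.setFld a x).fld c = m.fld c :=
  Function.update_of_ne h ..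

/-- The number cells below `a` and the field cells from `b` on have the same content. -/
structure Frame (a b : ℕ) (m m' : Mem F) : Prop where
  num : ∀ c < a, m'.num c = m.num c
  fld : ∀ c, b ≤ c → m'.fld c = m.fld c

namespace Frame

variable {a b : ℕ} {m m' m'' : Mem F}

theorem refl : Frame a b m m := ⟨fun _ _ => rfl, fun _ _ => rfl⟩

theorem trans (h : Frame a b m m') (h' : Frame a b m' m'') : Frame a b m m'' :=
  ⟨fun c hc => (h'.num c hc).trans (h.num c hc), fun c hc => (h'.fld c hc).trans (h.fld c hc)⟩

theorem mono {a' b' : ℕ} (h : Frame a b m m') (ha : a' ≤ a) (hb : b ≤ b') : Frame a' b' m m' :=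
  ⟨fun c hc => h.num c (hc.trans_le ha), fun c hc => h.fld c (hb.trans hc)⟩

theorem setNum (h : Frame a b m m') {i : ℕ} (hi : a ≤ i) (v : ℕ) :
    Frame a b m (m'.setNum i v) :=
  ⟨fun c hc => (m'.setNum_num_of_ne v (by omega)).trans (h.num c hc), h.fld⟩

theorem setFld (h : Frame a b m m') {i : ℕ} (hi : i < b) (x : F) : Frame a b m (m'.setFld i x) :=
  ⟨h.num, fun c hc => (m'.setFld_fld_of_ne x (by omega)).trans (h.fld c hc)⟩

end Frame

variable [Field F] {n : ℕ}

/-- Executed on the memory `m`, the program part `P` takes at most `T` steps and leads to a memory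
which satisfies `Q`. -/
def Runs (e : ℕ → F) (box : (Fin n → F) → F) (P : Prog) (T : ℕ) (m : Mem F) (Q : Mem F → Prop) :
    Prop :=
  ∃ t ≤ T, ∃ m', Q m' ∧ ∀ K, (step e box)^[t] ⟨P :: K, m⟩ = ⟨K, m'⟩

namespace Runs

variable {e : ℕ → F} {box : (Fin n → F) → F} {P P' : Prog} {T T' : ℕ} {m : Mem F}
  {Q Q' : Mem F → Prop}

theorem weaken (h : Runs e box P T m Q) (hT : T ≤ T') (hQ : ∀ m', Q m' → Q' m') :
    Runs e box P T' m Q' := by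
  obtain ⟨t, ht, m', hm', h⟩ := h
  exact ⟨t, ht.trans hT, m', hQ m' hm', h⟩

theorem mono (h : Runs e box P T m Q) (hT : T ≤ T') : Runs e box P T' m Q :=
  h.weaken hT fun _ => id

theorem imp (h : Runs e box P T m Q) (hQ : ∀ m', Q m' → Q' m') : Runs e box P T m Q' :=
  h.weaken le_rfl hQ

theorem nop (h : Q m) : Runs e box .nop 1 m Q := ⟨1, le_rfl, m, h, fun _ => rfl⟩

theorem setN {a v : NExp} (h : Q (m.setNum (a.val m) (v.val m))) :
    Runs e box (.setN a v) 1 m Q := ⟨1, le_rfl, _, h, fun _ => rfl⟩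

theorem setF {a : NExp} {x : FExp} (h : Q (m.setFld (a.val m) (x.val e m))) :
    Runs e box (.setF a x) 1 m Q := ⟨1, le_rfl, _, h, fun _ => rfl⟩

theorem query {a p : NExp} (h : Q (m.setFld (a.val m) (box fun i => m.fld (p.val m + i)))) :
    Runs e box (.query a p) 1 m Q := ⟨1, le_rfl, _, h, fun _ => rfl⟩

/-- The postcondition of the first part is that the second part runs correctly, so intermediate
assertions need not be given. The additional step splits the sequence. -/
theorem seq (h : Runs e box P T m fun m' => Runs e box P' T' m' Q) :
    Runs e box (.seq P P') (T + T' + 1) m Q := by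
  obtain ⟨t, ht, m', ⟨t', ht', m'', hQ, h'⟩, h⟩ := h
  refine ⟨t' + t + 1, by omega, m'', hQ, fun K => ?_⟩
  rw [Function.iterate_succ_apply, Function.iterate_add_apply]
  exact (congrArg _ (h (P' :: K))).trans (h' K)

theorem ite {b : Test} (h : b.Holds e m → Runs e box P T m Q)
    (h' : ¬ b.Holds e m → Runs e box P' T m Q) : Runs e box (.ite b P P') (T + 1) m Q := by
  by_cases hb : b.Holds e m
  · obtain ⟨t, ht, m', hQ, h⟩ := h hb
    refine ⟨t + 1, by omega, m', hQ, fun K => ?_⟩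
    rw [Function.iterate_succ_apply, step, if_pos hb, h]
  · obtain ⟨t, ht, m', hQ, h⟩ := h' hb
    refine ⟨t + 1, by omega, m', hQ, fun K => ?_⟩
    rw [Function.iterate_succ_apply, step, if_neg hb, h]

/-- A loop which is executed `N` times, with an invariant. -/
theorem loop {I : ℕ → Mem F → Prop} {b : Test} {N : ℕ} (h0 : I 0 m)
    (hstep : ∀ k < N, ∀ m, I k m → b.Holds e m ∧ Runs e box P T m (I (k + 1)))
    (hend : ∀ m, I N m → ¬ b.Holds e m ∧ Q m) :
    Runs e box (.loop b P) (N * (T + 1) + 1) m Q := by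
  have key : ∀ j k, k + j = N → ∀ m, I k m → Runs e box (.loop b P) (j * (T + 1) + 1) m Q := by
    intro j
    induction j with
    | zero =>
      intro k hk m hm
      obtain rfl : k = N := by omega
      obtain ⟨hb, hQ⟩ := hend m hm
      exact ⟨1, by omega, m, hQ, fun K => by rw [Function.iterate_one, step, if_neg hb]⟩
    | succ j ih =>
      intro k hk m hm
      obtain ⟨hb, t, ht, m', hm', h⟩ := hstep k (by omega) m hm
      obtain ⟨t', ht', m'', hQ, h'⟩ := ih (k + 1) (by omega) m' hm'
      refine ⟨t' + t + 1, by rw [add_mul]; omega, m'', hQ, fun K => ?_⟩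
      rw [Function.iterate_succ_apply, step, if_pos hb, Function.iterate_add_apply, h, h']
  exact key N 0 (by omega) m h0

end Runs

/-- The expression for the content of a number cell. -/
abbrev nc (i : ℕ) : NExp := .cell (.const i)

/-- The expression for the content of a field cell. -/
abbrev fc (i : ℕ) : FExp := .cell (.const i)

/-- The loop `for i = 0, …, bound - 1`. -/
def Prog.for (i : ℕ) (bound : NExp) (body : Prog) : Prog :=
  .seq (.setN (.const i) (.const 0))
    (.loop (.lt (nc i) bound) (.seq body (.setN (.const i) (.add (nc i) (.const 1)))))

namespace Runs

variable {e : ℕ → F} {box : (Fin n → F) → F}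

/-- A `for`-loop with an invariant `J` which does not depend on the loop counter, where the body
keeps the number cells up to the loop counter and the field cells from `b` on. -/
theorem for_frame {J : ℕ → Mem F → Prop} {i b N T : ℕ} {bound : NExp} {body : Prog} {m : Mem F}
    (hbound : ∀ m' : Mem F, (∀ c < i, m'.num c = m.num c) → bound.val m' = N)
    (hJ : ∀ k m' v, J k m' → J k (m'.setNum i v)) (h0 : J 0 m)
    (hstep : ∀ k < N, ∀ m', Frame i b m m' → m'.num i = k → J k m' →
      Runs e box body T m' fun m'' => Frame (i + 1) b m' m'' ∧ J (k + 1) m'') :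
    Runs e box (.for i bound body) (N * (T + 3) + 3) m fun m' => Frame i b m m' ∧ J N m' := by
  -- Each round costs the body, one step for its sequencing, the increment and the test of the loop.
  refine (seq (T' := N * (T + 1 + 1 + 1) + 1) (setN ?_)).mono (by ring_nf; omega)
  refine loop (I := fun k m' => m'.num i = k ∧ Frame i b m m' ∧ J k m') ?_ ?_ ?_
  · exact ⟨Mem.setNum_num_self _ _ _, Frame.refl.setNum le_rfl _, hJ _ _ _ h0⟩
  · rintro k hk m' ⟨hi, hfr, hJk⟩
    refine ⟨?_, seq ((hstep k hk m' hfr hi hJk).imp fun m'' h => ?_)⟩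
    · simp only [Test.Holds, NExp.val, hi, hbound m' hfr.num, hk]
    · obtain ⟨hfr', hJ'⟩ := h
      have hi' : m''.num i = k := (hfr'.num i (Nat.lt_succ_self i)).trans hi
      refine setN ⟨?_, ?_, ?_⟩
      · simp [NExp.val, hi']
      · exact (hfr.trans (hfr'.mono (Nat.le_succ i) le_rfl)).setNum le_rfl _
      · exact hJ _ _ _ hJ'
  · rintro m' ⟨hi, hfr, hJN⟩
    refine ⟨?_, hfr, hJN⟩
    simp only [Test.Holds, NExp.val, hi, hbound m' hfr.num, lt_irrefl, not_false_eq_true]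

end Runs

end Logic

/-! ## The program

The number cells are used as follows: `0, 1, 2` for `n, d, r`; `3` for the base `B` of the digits of
the seeds; `4` for the exponent `D`; `5` for the number of levels; `6` for the number of seeds; `7`
for the seed; `8` for the output flag; `9` for the coordinate; `10` for the level; `11` for the
number of the block; `12` for the rest of the seed; `13` for quotients; `14` for an exponent; from
`15` on for inner loops. The field cells are used as follows: `0` and `1` for a product and a sum,
`2` for the argument of an interpolation, `3` and `4` for `α ω ^ l` and `ω`, `5` for the answer of
the black box; from `6` on for a row with `r + 1` entries, then for a second such row, then for a
point. -/

section Fragments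

open Prog

variable {F : Type*} [Field F] {n : ℕ} {e : ℕ → F} {box : (Fin n → F) → F}

/-- Field cell `1` is set to the interpolation of the row at the content of cell `2`. -/
def interpProg : Prog :=
  seq (setF (.const 1) .zero) <|
  Prog.for 16 (.add (nc 2) (.const 1)) <|
    seq (setF (.const 0) (.cell (.add (.const 6) (nc 16)))) <|
    seq (Prog.for 17 (.add (nc 2) (.const 1)) <|
      ite (.isZero (.sub (.enum (nc 16)) (.enum (nc 17)))) nop <|
        setF (.const 0) (.mul (fc 0) (.mul (.sub (fc 2) (.enum (nc 17)))
          (.inv (.sub (.enum (nc 16)) (.enum (nc 17))))))) <|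
    setF (.const 1) (.add (fc 1) (fc 0))

/-- Here and below `W` is a common upper bound for the numbers involved, and `16 ≤ W` absorbs the
constants into a power of `W`. Two nested loops of length `r + 1` cost `O(W ^ 2)`. -/
theorem runs_interpProg {W : ℕ} (hW : 16 ≤ W) (m : Mem F) (hr : m.num 2 + 1 ≤ W) :
    Runs e box interpProg (W ^ 3) m fun m' => Frame 16 2 m m' ∧
      m'.fld 1 = interp e (m.num 2) (fun l => m.fld (6 + l)) (m.fld 2) := by
  set r := m.num 2 with hr'
  refine Runs.mono (T := 1 + ((r + 1) * ((1 + ((r + 1) * (2 + 3) + 3 + 1 + 1) + 1) + 3) + 3) + 1)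
    ?_ ?_
  · refine Runs.seq (Runs.setF ?_)
    set m₁ := m.setFld ((NExp.const 1).val m) (FExp.zero.val e m) with hm₁
    have h01 : Frame 16 2 m m₁ := Frame.refl.setFld (by simp [NExp.val]) _
    refine (Runs.for_frame (b := 2) (J := fun k m' => m'.fld 1 = ∑ j ∈ Finset.range k,
      m.fld (6 + j) * lagrangeValue e r (m.fld 2) j) ?_ (fun _ _ _ h => h) ?_ ?_).imp ?_
    · intro m' h
      simp [NExp.val, h 2 (by norm_num), hr', hm₁]
    · simp [hm₁, NExp.val, FExp.val]
    · intro k hk m₂ h12 hk16 hJ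
      have h02 := h01.trans h12
      refine Runs.seq (Runs.setF ?_)
      set m₃ := m₂.setFld ((NExp.const 0).val m₂)
        ((FExp.cell (.add (.const 6) (nc 16))).val e m₂) with hm₃
      have h3n : m₃.num = m₂.num := rfl
      have h3 : m₃.fld 0 = m.fld (6 + k) := by
        simp [hm₃, NExp.val, FExp.val, hk16, h02.fld (6 + k) (by omega)]
      have h23 : Frame 17 1 m₂ m₃ := Frame.refl.setFld (by simp [NExp.val]) _
      -- The product starts with the row entry instead of `1`, so it ends as the `k`-th summand of
      -- the interpolation.
      refine Runs.seq (T := (r + 1) * (2 + 3) + 3) (T' := 1) ((Runs.for_frame (b := 1) (N := r + 1) (T := 2)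
        (J := fun b m' => m'.fld 0 = m.fld (6 + k) * ∏ b ∈ Finset.range b,
          open Classical in if e k - e b = 0 then 1 else
            (m.fld 2 - e b) * (e k - e b)⁻¹) ?_ (fun _ _ _ h => h) ?_ ?_).imp ?_)
      · intro m' h
        simp [NExp.val, h 2 (by norm_num), h3n, h02.num 2 (by norm_num), hr']
      · simpa using h3
      · intro b hb m₄ h34 hb17 hJ'
        have h24 := h23.trans h34
        have h16 : m₄.num 16 = k := (h24.num 16 (by norm_num)).trans hk16
        have hv : m₄.fld 2 = m.fld 2 :=
          (h24.fld 2 (by norm_num)).trans (h02.fld 2 le_rfl)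
        refine Runs.ite (fun h => Runs.nop ⟨Frame.refl, ?_⟩) fun h => Runs.setF ⟨?_, ?_⟩
        · simp only [Test.Holds, FExp.val, NExp.val, h16, hb17] at h
          rw [Finset.prod_range_succ, if_pos h, mul_one, hJ']
        · exact Frame.refl.setFld (by simp [NExp.val]) _
        · simp only [Test.Holds, FExp.val, NExp.val, h16, hb17] at h
          simp only [NExp.val, FExp.val, Mem.setFld_fld_self, h16, hb17, hv, hJ']
          rw [Finset.prod_range_succ, if_neg h, mul_assoc]
      · rintro m₅ ⟨h35, hJ'⟩
        have h25 := h23.trans h35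
        refine Runs.setF ⟨(h25.mono le_rfl (by norm_num)).setFld (by simp [NExp.val]) _, ?_⟩
        simp only [NExp.val, FExp.val, Mem.setFld_fld_self, hJ', h25.fld 1 le_rfl, hJ]
        rw [Finset.sum_range_succ, lagrangeValue]
    · rintro m' ⟨h1, h2⟩
      exact ⟨h01.trans h1, h2⟩
  · nlinarith [Nat.mul_le_mul hr hr, Nat.mul_le_mul hW (Nat.mul_le_mul_left W (le_refl W))]

/-- Field cell `2` is set to a power of the content of cell `3`, with the exponent in number
cell `14`. -/
def powProg : Prog :=
  seq (setF (.const 2) .one) <| Prog.for 16 (nc 14) <| setF (.const 2) (.mul (fc 2) (fc 3))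

theorem runs_powProg (m : Mem F) :
    Runs e box powProg (m.num 14 * 4 + 5) m fun m' => Frame 16 3 m m' ∧
      m'.fld 2 = m.fld 3 ^ m.num 14 := by
  refine (Runs.seq (T := 1) (T' := m.num 14 * (1 + 3) + 3) (Runs.setF ?_)).mono (by omega)
  set m₁ := m.setFld ((NExp.const 2).val m) (FExp.one.val e m) with hm₁
  have h01 : Frame 16 3 m m₁ := Frame.refl.setFld (by simp [NExp.val]) _
  refine (Runs.for_frame (b := 3) (J := fun k m' => m'.fld 2 = m.fld 3 ^ k) ?_
    (fun _ _ _ h => h) ?_ ?_).imp ?_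
  · intro m' h
    simp [NExp.val, h 14 (by norm_num), hm₁]
  · simp [hm₁, NExp.val, FExp.val]
  · intro k hk m₂ h12 hk16 hJ
    refine Runs.setF ⟨Frame.refl.setFld (by simp [NExp.val]) _, ?_⟩
    simp [NExp.val, FExp.val, hJ, (h01.trans h12).fld 3 le_rfl, pow_succ]
  · rintro m' ⟨h1, h2⟩
    exact ⟨h01.trans h1, h2⟩

/-- Number cell `x` is replaced by its remainder modulo `d`, and cell `13` is set to the
quotient. -/
def divProg (x : ℕ) (d : NExp) : Prog :=
  seq (setN (.const 13) (.const 0)) <|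
  loop (.not (.lt (nc x) d)) <|
    seq (setN (.const x) (.sub (nc x) d)) (setN (.const 13) (.add (nc 13) (.const 1)))

/-- Repeated subtraction, with at most `W` rounds as `q ≥ 1`. By `hd` the divisor is not affected by
the two cells that change. -/
theorem runs_divProg {x : ℕ} {d : NExp} {W q : ℕ} (hx : x ≠ 13) (m : Mem F) (hq : 0 < q)
    (hd : ∀ m' : Mem F, (∀ c, c ≠ 13 → c ≠ x → m'.num c = m.num c) → d.val m' = q)
    (hW : m.num x ≤ W) :
    Runs e box (divProg x d) (W * 4 + 3) m fun m' => m'.fld = m.fld ∧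
      m'.num x = m.num x % q ∧ m'.num 13 = m.num x / q ∧
      ∀ c, c ≠ 13 → c ≠ x → m'.num c = m.num c := by
  refine (Runs.seq (T := 1) (T' := m.num x / q * ((1 + 1 + 1) + 1) + 1) (Runs.setN ?_)).mono (by
    have := Nat.div_le_self (m.num x) q
    omega)
  refine Runs.loop (I := fun k m' => m'.fld = m.fld ∧ m'.num x + k * q = m.num x ∧
    m'.num 13 = k ∧ ∀ c, c ≠ 13 → c ≠ x → m'.num c = m.num c) ?_ ?_ ?_
  · refine ⟨rfl, ?_, ?_, fun c h13 hcx => ?_⟩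
    · simp [NExp.val, Mem.setNum_num_of_ne _ _ hx]
    · simp [NExp.val]
    · exact Mem.setNum_num_of_ne _ _ h13
  · rintro k hk m₁ ⟨hf, h1, h2, h3⟩
    have hdq := hd m₁ h3
    have hle : q ≤ m₁.num x := by
      have : (k + 1) * q ≤ m.num x := (Nat.mul_le_mul_right q hk).trans (Nat.div_mul_le_self _ _)
      rw [add_mul] at this
      omega
    refine ⟨by simp [Test.Holds, NExp.val, hdq, hle], Runs.seq (Runs.setN (Runs.setN ?_))⟩
    simp only [NExp.val, hdq]
    refine ⟨hf, ?_, ?_, fun c h13 hcx => ?_⟩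
    · rw [Mem.setNum_num_of_ne _ _ hx, Mem.setNum_num_self, add_mul]
      omega
    · rw [Mem.setNum_num_self, Mem.setNum_num_of_ne _ _ hx.symm, h2]
    · rw [Mem.setNum_num_of_ne _ _ h13, Mem.setNum_num_of_ne _ _ hcx, h3 c h13 hcx]
  · rintro m₁ ⟨hf, h1, h2, h3⟩
    have hmod := Nat.div_add_mod (m.num x) q
    rw [mul_comm] at hmod
    have h4 : m₁.num x = m.num x % q := by omega
    refine ⟨?_, hf, h4, h2, h3⟩
    simpa [Test.Holds, NExp.val, hd m₁ h3, h4] using Nat.mod_lt _ hq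

end Fragments

/-! ### The program for one level of the generator -/

section Level

open Prog

variable {F : Type*} [Field F] {n : ℕ} {e : ℕ → F} {box : (Fin n → F) → F}

/-- The last digit of the seed is removed, and the field element with this number is written to
cell `x`. -/
def digitProg (x : ℕ) : Prog :=
  seq (divProg 12 (nc 3)) <| seq (setF (.const x) (.enum (nc 12))) <| setN (.const 12) (nc 13)

theorem runs_digitProg {W : ℕ} (x : ℕ) (m : Mem F) (hB : 0 < m.num 3) (hW : m.num 12 ≤ W) :
    Runs e box (digitProg x) (W * 4 + 7) m fun m' => m'.num 12 = m.num 12 / m.num 3 ∧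
      (∀ c, c ≠ 12 → c ≠ 13 → m'.num c = m.num c) ∧
      m'.fld x = e (m.num 12 % m.num 3) ∧ ∀ c, c ≠ x → m'.fld c = m.fld c := by
  refine (Runs.seq (T := W * 4 + 3) (T' := 1 + 1 + 1) ((runs_divProg (d := nc 3) (q := m.num 3) (by norm_num) m
    hB (fun m' h => h 3 (by norm_num) (by norm_num)) hW).imp ?_)).mono (by omega)
  rintro m₁ ⟨hf, h12, h13, hn⟩
  refine Runs.seq (Runs.setF (Runs.setN ⟨?_, fun c hc hc' => ?_, ?_, fun c hc => ?_⟩))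
  · simp [NExp.val, h13]
  · simp only [NExp.val]
    rw [Mem.setNum_num_of_ne _ _ hc, Mem.setFld_num, hn c hc' hc]
  · simp [NExp.val, FExp.val, h12]
  · simp only [NExp.val, Mem.setNum_fld]
    rw [Mem.setFld_fld_of_ne _ _ hc, hf]

/-- The number of the block is halved, and the exponent is set according to its parity. -/
def parityProg : Prog :=
  seq (divProg 11 (.const 2)) <|
  seq (ite (.lt (nc 11) (.const 1)) (setN (.const 14) (.const 1)) (setN (.const 14) (nc 4))) <|
  setN (.const 11) (nc 13)

theorem runs_parityProg {W : ℕ} (m : Mem F) (hW : m.num 11 ≤ W) :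
    Runs e box parityProg (W * 4 + 8) m fun m' => m'.num 11 = m.num 11 / 2 ∧
      m'.num 14 = (if m.num 11 % 2 = 0 then 1 else m.num 4) ∧
      (∀ c, c ≠ 11 → c ≠ 13 → c ≠ 14 → m'.num c = m.num c) ∧ m'.fld = m.fld := by
  refine (Runs.seq (T := W * 4 + 3) (T' := (1 + 1) + 1 + 1) ((runs_divProg (q := 2) (by norm_num) m
    (by norm_num) (fun m' h => rfl) hW).imp ?_)).mono (by omega)
  rintro m₁ ⟨hf, h11, h13, hn⟩
  refine Runs.seq (T := 1 + 1) (T' := 1) (Runs.ite (fun h => ?_) fun h => ?_)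
  · refine Runs.setN (Runs.setN ⟨?_, ?_, fun c hc hc' hc'' => ?_, hf⟩)
    · simp [NExp.val, h13, Mem.setNum_num_of_ne]
    · have h0 : m.num 11 % 2 = 0 := by
        simpa [Test.Holds, NExp.val, h11] using h
      simp [NExp.val, h0, Mem.setNum_num_of_ne]
    · simp only [NExp.val]
      rw [Mem.setNum_num_of_ne _ _ hc, Mem.setNum_num_of_ne _ _ hc'', hn c hc' hc]
  · refine Runs.setN (Runs.setN ⟨?_, ?_, fun c hc hc' hc'' => ?_, hf⟩)
    · simp [NExp.val, h13, Mem.setNum_num_of_ne]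
    · have h0 : ¬ m.num 11 % 2 = 0 := by
        simpa [Test.Holds, NExp.val, h11] using h
      rw [if_neg h0]
      simp [NExp.val, Mem.setNum_num_of_ne, hn 4]
    · simp only [NExp.val]
      rw [Mem.setNum_num_of_ne _ _ hc, Mem.setNum_num_of_ne _ _ hc'', hn c hc' hc]

/-- The row is replaced by its interpolations at the powers of the elements `α ω ^ l`. -/
def rowProg : Prog :=
  seq (Prog.for 15 (.add (nc 2) (.const 1)) <|
    seq powProg <| seq interpProg <|
    seq (setF (.add (.const 7) (.add (nc 2) (nc 15))) (fc 1)) <|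
    setF (.const 3) (.mul (fc 3) (fc 4))) <|
  Prog.for 15 (.add (nc 2) (.const 1)) <|
    setF (.add (.const 6) (nc 15)) (.cell (.add (.const 7) (.add (nc 2) (nc 15))))

/-- Each new entry needs the whole old row, so the new row is built in a second array, from cell `7
+ r` on, and copied back at the end. Cell `3` runs through the `α ω ^ l`. -/
theorem runs_rowProg {W : ℕ} (hW : 16 ≤ W) (m : Mem F) (hr : m.num 2 + 1 ≤ W)
    (hE : m.num 14 ≤ W) :
    Runs e box rowProg (W ^ 5) m fun m' => Frame 15 (8 + 2 * m.num 2) m m' ∧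
      ∀ l < m.num 2 + 1, m'.fld (6 + l) = interp e (m.num 2) (fun l => m.fld (6 + l))
        ((m.fld 3 * m.fld 4 ^ l) ^ m.num 14) := by
  set r := m.num 2 with hr'
  set X : ℕ → F := fun l => interp e r (fun l => m.fld (6 + l))
    ((m.fld 3 * m.fld 4 ^ l) ^ m.num 14) with hX
  set T₁ := m.num 14 * 4 + 5 + (W ^ 3 + (1 + 1 + 1) + 1) + 1 with hT₁
  refine (Runs.seq (T := (r + 1) * (T₁ + 3) + 3) (T' := (r + 1) * (1 + 3) + 3)
    ((Runs.for_frame (b := 8 + 2 * r) (J := fun k m' => m'.fld 3 = m.fld 3 * m.fld 4 ^ k ∧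
      m'.fld 4 = m.fld 4 ∧ (∀ l < k, m'.fld (7 + r + l) = X l) ∧
      ∀ l < r + 1, m'.fld (6 + l) = m.fld (6 + l)) ?_ (fun _ _ _ h => h) ?_ ?_).imp ?_)).mono ?_
  · intro m' h
    simp [NExp.val, h 2 (by norm_num), hr']
  · simp
  · rintro k hk m₁ h01 hk15 ⟨h3, h4, hnew, hold⟩
    have hm2 : m₁.num 2 = r := h01.num 2 (by norm_num)
    have hm14 : m₁.num 14 = m.num 14 := h01.num 14 (by norm_num)
    rw [hT₁, ← hm14]
    refine Runs.seq ((runs_powProg m₁).imp ?_)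
    rintro m₂ ⟨h12, hv⟩
    refine Runs.seq ((runs_interpProg hW m₂ (by rwa [h12.num 2 (by norm_num), hm2])).imp ?_)
    rintro m₃ ⟨h23, hacc⟩
    have h13 : Frame 16 3 m₁ m₃ := h12.trans (h23.mono le_rfl (by norm_num))
    have hacc' : m₃.fld 1 = X k := by
      rw [hacc, h12.num 2 (by norm_num), hm2, hv, h3, hm14]
      refine interp_congr (fun l hl => ?_) _
      exact (h12.fld _ (by omega)).trans (hold l hl)
    have h32 : m₃.num 2 = r := (h13.num 2 (by norm_num)).trans hm2
    have h315 : m₃.num 15 = k := (h13.num 15 (by norm_num)).trans hk15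
    refine Runs.seq (Runs.setF (Runs.setF ?_))
    simp only [NExp.val, FExp.val, h32, h315]
    refine ⟨(((h13.mono le_rfl (by omega)).setFld (by omega) _).setFld (by omega) _), ?_, ?_,
      fun l hl => ?_, fun l hl => ?_⟩
    · rw [Mem.setFld_fld_self, Mem.setFld_fld_of_ne _ _ (by omega),
        Mem.setFld_fld_of_ne _ _ (by omega), h13.fld 3 le_rfl, h13.fld 4 (by norm_num), h3, h4,
        pow_succ, mul_assoc]
    · rw [Mem.setFld_fld_of_ne _ _ (by omega), Mem.setFld_fld_of_ne _ _ (by omega),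
        h13.fld 4 (by norm_num), h4]
    · rw [Mem.setFld_fld_of_ne _ _ (by omega)]
      rcases Nat.lt_succ_iff_lt_or_eq.1 hl with hl' | rfl
      · rw [Mem.setFld_fld_of_ne _ _ (by omega), h13.fld _ (by omega), hnew l hl']
      · rw [← add_assoc, Mem.setFld_fld_self, hacc']
    · rw [Mem.setFld_fld_of_ne _ _ (by omega), Mem.setFld_fld_of_ne _ _ (by omega),
        h13.fld _ (by omega), hold l hl]
  · rintro m₁ ⟨h01, -, -, hnew, -⟩
    refine (Runs.for_frame (b := 8 + 2 * r) (J := fun k m' => (∀ l < k, m'.fld (6 + l) = X l) ∧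
      ∀ l < r + 1, m'.fld (7 + r + l) = X l) ?_ (fun _ _ _ h => h) ⟨by simp, hnew⟩ ?_).imp ?_
    · intro m' h
      simp [NExp.val, h 2 (by norm_num), h01.num 2 (by norm_num), hr']
    · rintro k hk m₂ h12 hk15 ⟨hX1, hX2⟩
      have h22 : m₂.num 2 = r := (h12.num 2 (by norm_num)).trans (h01.num 2 (by norm_num))
      refine Runs.setF ?_
      simp only [NExp.val, FExp.val, h22, hk15]
      refine ⟨Frame.refl.setFld (by omega) _, fun l hl => ?_, fun l hl => ?_⟩
      · rcases Nat.lt_succ_iff_lt_or_eq.1 hl with hl' | rfl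
        · rw [Mem.setFld_fld_of_ne _ _ (by omega), hX1 l hl']
        · rw [Mem.setFld_fld_self, ← hX2 l hk, add_assoc]
      · rw [Mem.setFld_fld_of_ne _ _ (by omega), hX2 l hl]
    · rintro m' ⟨h1, h2, -⟩
      exact ⟨h01.trans h1, h2⟩
  · have hT : T₁ ≤ W * 4 + W ^ 3 + 10 := by omega
    have h2 : 16 * W ≤ W ^ 2 := by nlinarith
    have h3 : 16 * W ^ 2 ≤ W ^ 3 := by
      rw [pow_succ W 2, mul_comm]; exact Nat.mul_le_mul_left _ hW
    have h4 : 16 * W ^ 3 ≤ W ^ 4 := by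
      rw [pow_succ W 3, mul_comm]; exact Nat.mul_le_mul_left _ hW
    calc (r + 1) * (T₁ + 3) + 3 + ((r + 1) * (1 + 3) + 3) + 1
        ≤ W * (W * 4 + W ^ 3 + 10 + 3) + 3 + (W * (1 + 3) + 3) + 1 := by gcongr
      _ ≤ W * (W * 4 + W ^ 3 + 10 + 3) + W * 5 := by omega
      _ = W * (W * 4 + W ^ 3 + 18) := by ring
      _ ≤ W * W ^ 4 := Nat.mul_le_mul_left _ (by omega)
      _ = W ^ 5 := by ring

/-- One level of the generator. -/
def levelProg : Prog := seq (digitProg 4) <| seq (digitProg 3) <| seq parityProg rowProg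

/-- The digits are taken in the order used by `genCoord`: first `ω` (cell `4`), then `α` (cell `3`).
-/
theorem runs_levelProg {W : ℕ} (hW : 16 ≤ W) (m : Mem F) (hr : m.num 2 + 1 ≤ W)
    (hB : 0 < m.num 3) (hD : m.num 4 ≤ W) (hq : m.num 11 ≤ W) (ht : m.num 12 ≤ W) :
    Runs e box levelProg (W ^ 6) m fun m' => Frame 11 (8 + 2 * m.num 2) m m' ∧
      m'.num 11 = m.num 11 / 2 ∧ m'.num 12 = m.num 12 / m.num 3 / m.num 3 ∧
      ∀ l < m.num 2 + 1, m'.fld (6 + l) = nextRow e (m.num 2) (m.num 4) (fun l => m.fld (6 + l))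
        (e (m.num 12 % m.num 3)) (e (m.num 12 / m.num 3 % m.num 3)) (m.num 11) l := by
  refine (Runs.seq (T := W * 4 + 7) (T' := W * 4 + 7 + (W * 4 + 8 + W ^ 5 + 1) + 1)
    ((runs_digitProg 4 m hB ht).imp ?_)).mono ?_
  · rintro m₁ ⟨h12, hn, h4, hf⟩
    have hn3 : m₁.num 3 = m.num 3 := hn 3 (by norm_num) (by norm_num)
    refine Runs.seq ((runs_digitProg 3 m₁ (by rwa [hn3])
      (by rw [h12]; exact (Nat.div_le_self _ _).trans ht)).imp ?_)
    rintro m₂ ⟨h12', hn', h3', hf'⟩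
    have hn2 : ∀ c, c ≠ 12 → c ≠ 13 → m₂.num c = m.num c := fun c hc hc' =>
      (hn' c hc hc').trans (hn c hc hc')
    refine Runs.seq ((runs_parityProg m₂
      (by rwa [hn2 11 (by norm_num) (by norm_num)])).imp ?_)
    rintro m₃ ⟨h11, h14, hn'', hf''⟩
    have hn3' : ∀ c < 11, m₃.num c = m.num c := fun c hc =>
      (hn'' c (by omega) (by omega) (by omega)).trans (hn2 c (by omega) (by omega))
    rw [hn2 11 (by norm_num) (by norm_num)] at h11
    rw [hn2 11 (by norm_num) (by norm_num), hn2 4 (by norm_num) (by norm_num)] at h14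
    refine (runs_rowProg hW m₃ (by rwa [hn3' 2 (by norm_num)]) (by
      rw [h14]; split_ifs <;> omega)).imp ?_
    rintro m₄ ⟨h34, hrow⟩
    rw [hn3' 2 (by norm_num)] at h34 hrow
    refine ⟨⟨fun c hc => (h34.num c (by omega)).trans (hn3' c hc), fun c hc => ?_⟩, ?_, ?_,
      fun l hl => ?_⟩
    · rw [h34.fld c hc, hf'', hf' c (by omega), hf c (by omega)]
    · rw [h34.num 11 (by norm_num), h11]
    · rw [h34.num 12 (by norm_num), hn'' 12 (by norm_num) (by norm_num) (by norm_num), h12', h12,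
        hn3]
    · rw [hrow l hl, nextRow, h14, hf'', h3', hf' 4 (by norm_num), h4, h12, hn3]
      refine interp_congr (fun l _ => ?_) _
      rw [hf' _ (by omega), hf _ (by omega)]
  · have h2 : 16 * W ^ 5 ≤ W ^ 6 := by
      rw [pow_succ W 5, mul_comm]; exact Nat.mul_le_mul_left _ hW
    have h1 : W ≤ W ^ 5 := Nat.le_self_pow (by norm_num) W
    omega

end Level

/-! ### The programs for one coordinate and for one seed -/

section Seeds

open Prog

variable {F : Type*} [Field F] {n : ℕ} {e : ℕ → F} {box : (Fin n → F) → F}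

/-- One coordinate of the generator. -/
def coordProg : Prog :=
  seq (setN (.const 11) (nc 9)) <| seq (setN (.const 12) (nc 7)) <|
  seq (Prog.for 15 (.add (nc 2) (.const 1)) <| setF (.add (.const 6) (nc 15)) (.enum (nc 15))) <|
  seq (Prog.for 10 (nc 5) levelProg) <|
  seq (setF (.const 2) (.enum (nc 12))) <| seq interpProg <|
  setF (.add (.const 8) (.add (nc 2) (.add (nc 2) (nc 9)))) (fc 1)

theorem runs_coordProg {W : ℕ} (hW : 16 ≤ W) (m : Mem F) (hr : m.num 2 + 1 ≤ W)
    (hB : 0 < m.num 3) (hD : m.num 4 ≤ W) (hK : m.num 5 ≤ W) (hi : m.num 9 ≤ W)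
    (hs : m.num 7 ≤ W) :
    Runs e box coordProg (W ^ 8) m fun m' => (∀ c < 10, m'.num c = m.num c) ∧
      (∀ c, 8 + 2 * m.num 2 ≤ c → c ≠ 8 + 2 * m.num 2 + m.num 9 → m'.fld c = m.fld c) ∧
      m'.fld (8 + 2 * m.num 2 + m.num 9) =
        genCoord e (m.num 2) (m.num 4) (m.num 3) (m.num 5) e (m.num 9) (m.num 7) := by
  set r := m.num 2 with hr'
  set B := m.num 3 with hB'
  set D := m.num 4 with hD'
  set K := m.num 5 with hK'
  refine (Runs.seq (T := 1) (T' := 1 + (((r + 1) * (1 + 3) + 3) + ((K * (W ^ 6 + 3) + 3) +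
    (1 + (W ^ 3 + 1 + 1) + 1) + 1) + 1) + 1) (Runs.setN (Runs.seq (Runs.setN
    (Runs.seq ?_))))).mono ?_
  · set m₁ := (m.setNum ((NExp.const 11).val m) ((nc 9).val m)).setNum
      ((NExp.const 12).val (m.setNum ((NExp.const 11).val m) ((nc 9).val m)))
      ((nc 7).val (m.setNum ((NExp.const 11).val m) ((nc 9).val m))) with hm₁
    have h01 : Frame 11 (8 + 2 * r) m m₁ :=
      (Frame.refl.setNum (by simp [NExp.val]) _).setNum (by simp [NExp.val]) _
    have h11 : m₁.num 11 = m.num 9 := by simp [hm₁, NExp.val, Mem.setNum_num_of_ne]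
    have h12 : m₁.num 12 = m.num 7 := by simp [hm₁, NExp.val, Mem.setNum_num_of_ne]
    refine (Runs.for_frame (b := 8 + 2 * r) (J := fun k m' => ∀ l < k, m'.fld (6 + l) = e l) ?_
      (fun _ _ _ h => h) (by simp) ?_).imp ?_
    · intro m' h
      simp [NExp.val, h 2 (by norm_num), h01.num 2 (by norm_num), hr']
    · rintro k hk m₂ h12 hk15 hJ
      refine Runs.setF ?_
      simp only [NExp.val, FExp.val, hk15]
      refine ⟨Frame.refl.setFld (by omega) _, fun l hl => ?_⟩
      rcases Nat.lt_succ_iff_lt_or_eq.1 hl with hl' | rfl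
      · rw [Mem.setFld_fld_of_ne _ _ (by omega), hJ l hl']
      · rw [Mem.setFld_fld_self]
    rintro m₂ ⟨h12f, hrow⟩
    have h02 : Frame 11 (8 + 2 * r) m m₂ := h01.trans (h12f.mono (by norm_num) le_rfl)
    rw [← h12f.num 11 (by norm_num)] at h11
    rw [← h12f.num 12 (by norm_num)] at h12
    -- Tail recursion: the remaining `K - k` levels, applied to the current row, block number and
    -- rest of the seed, always give the coordinate to be computed.
    refine Runs.seq ((Runs.for_frame (b := 8 + 2 * r) (J := fun k m' =>
      m'.num 11 ≤ W ∧ m'.num 12 ≤ W ∧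
      genCoord e r D B (K - k) (fun l => m'.fld (6 + l)) (m'.num 11) (m'.num 12) =
        genCoord e r D B K e (m.num 9) (m.num 7)) ?_ ?_ ?_ ?_).imp ?_)
    · intro m' h
      simp [NExp.val, h 5 (by norm_num), h02.num 5 (by norm_num), hK']
    · rintro k m' v h
      rwa [Mem.setNum_num_of_ne _ _ (by norm_num), Mem.setNum_num_of_ne _ _ (by norm_num)]
    · rw [h11, h12]
      exact ⟨hi, hs, genCoord_congr hrow _ _ _⟩
    · rintro k hk m₃ h23 hk10 ⟨hq, ht, hgen⟩
      have h03 : ∀ c < 10, m₃.num c = m.num c := fun c hc =>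
        (h23.num c hc).trans (h02.num c (by omega))
      have e2 := h03 2 (by norm_num)
      have e3 := h03 3 (by norm_num)
      have e4 := h03 4 (by norm_num)
      refine (runs_levelProg hW m₃ (by rwa [e2]) (by rwa [e3]) (by rwa [e4]) hq ht).imp ?_
      rintro m₄ ⟨h34, h11', h12', hrow'⟩
      rw [e2] at h34 hrow'
      rw [e3, e4] at hrow'
      rw [e3] at h12'
      refine ⟨h34, ?_, ?_, ?_⟩
      · rw [h11']; exact (Nat.div_le_self _ _).trans hq
      · rw [h12']; exact ((Nat.div_le_self _ _).trans (Nat.div_le_self _ _)).trans ht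
      · rw [← hgen, h11', h12', show K - k = K - (k + 1) + 1 by omega, genCoord]
        exact genCoord_congr hrow' _ _ _
    · rintro m₃ ⟨h23, -, -, hgen⟩
      rw [Nat.sub_self, genCoord] at hgen
      have h03 : ∀ c < 10, m₃.num c = m.num c := fun c hc =>
        (h23.num c hc).trans (h02.num c (by omega))
      refine Runs.seq (Runs.setF (Runs.seq ((runs_interpProg hW _ ?_).imp ?_)))
      · simpa [h03 2] using hr
      rintro m₄ ⟨h34, hacc⟩
      simp only [NExp.val, FExp.val, Mem.setFld_num, Mem.setFld_fld_self, h03 2 (by norm_num)]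
        at h34 hacc
      have h04 : ∀ c < 10, m₄.num c = m.num c := fun c hc =>
        (h34.num c (by omega)).trans (h03 c hc)
      have hacc' : m₄.fld 1 = genCoord e r D B K e (m.num 9) (m.num 7) := by
        rw [hacc, ← hgen]
        exact interp_congr (fun l _ => Mem.setFld_fld_of_ne _ _ (by omega)) _
      have haddr : 8 + (r + (r + m.num 9)) = 8 + 2 * r + m.num 9 := by ring
      refine Runs.setF ?_
      simp only [NExp.val, FExp.val, h04 2 (by norm_num), h04 9 (by norm_num), ← hr', haddr, hacc']
      refine ⟨h04, fun c hc hc' => ?_, Mem.setFld_fld_self _ _ _⟩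
      rw [Mem.setFld_fld_of_ne _ _ hc', h34.fld c (by omega), Mem.setFld_fld_of_ne _ _ (by omega),
        h23.fld c hc, h02.fld c hc]
  · have h4 : 16 * W ^ 7 ≤ W ^ 8 := by
      rw [pow_succ W 7, mul_comm]; exact Nat.mul_le_mul_left _ hW
    have h1 : W ≤ W ^ 7 := Nat.le_self_pow (by norm_num) W
    have h3 : W ^ 3 ≤ W ^ 7 := Nat.pow_le_pow_right (by omega) (by norm_num)
    calc _ ≤ 1 + (1 + ((W * (1 + 3) + 3) + ((W * (W ^ 6 + 3) + 3) +
            (1 + (W ^ 3 + 1 + 1) + 1) + 1) + 1) + 1) + 1 := by gcongr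
      _ = W ^ 7 + W * 7 + W ^ 3 + 16 := by ring
      _ ≤ W ^ 8 := by omega

/-- One query. -/
def seedProg : Prog :=
  seq (Prog.for 9 (nc 0) coordProg) <|
  seq (query (.const 5) (.add (.const 8) (.add (nc 2) (nc 2)))) <|
  ite (.isZero (fc 5)) nop (setN (.const 8) (.const 0))

open Classical in
-- The flag in cell `8` is only ever cleared, namely by a nonzero answer of the black box.
theorem runs_seedProg {W : ℕ} (hW : 16 ≤ W) (m : Mem F) (h0 : m.num 0 = n) (hn : n ≤ W)
    (hr : m.num 2 + 1 ≤ W) (hB : 0 < m.num 3) (hD : m.num 4 ≤ W) (hK : m.num 5 ≤ W)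
    (hs : m.num 7 ≤ W) :
    Runs e box seedProg (W ^ 10) m fun m' => Frame 8 (8 + 2 * m.num 2 + n) m m' ∧
      m'.num 8 = if (box fun i =>
        genCoord e (m.num 2) (m.num 4) (m.num 3) (m.num 5) e i (m.num 7)) = 0
        then m.num 8 else 0 := by
  set r := m.num 2 with hr'
  refine (Runs.seq (T := n * (W ^ 8 + 3) + 3) (T' := 1 + (1 + 1) + 1) ((Runs.for_frame
    (b := 8 + 2 * r + n) (J := fun k m' => ∀ i < k, m'.fld (8 + 2 * r + i) =
      genCoord e r (m.num 4) (m.num 3) (m.num 5) e i (m.num 7)) ?_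
      (fun _ _ _ h => h) (by simp) ?_).imp ?_)).mono ?_
  · intro m' h
    simp [NExp.val, h 0 (by norm_num), h0]
  · rintro k hk m₁ h01 hk9 hJ
    have e2 := h01.num 2 (by norm_num)
    have e3 := h01.num 3 (by norm_num)
    have e4 := h01.num 4 (by norm_num)
    have e5 := h01.num 5 (by norm_num)
    have e7 := h01.num 7 (by norm_num)
    refine (runs_coordProg hW m₁ (by rwa [e2]) (by rwa [e3]) (by rwa [e4]) (by rwa [e5])
      (by omega) (by rwa [e7])).imp ?_
    rintro m₂ ⟨hnum, hfld, hpt⟩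
    rw [e2, hk9] at hfld
    rw [e2, e3, e4, e5, e7, hk9] at hpt
    refine ⟨⟨hnum, fun c hc => hfld c (by omega) (by omega)⟩, fun i hi => ?_⟩
    rcases Nat.lt_succ_iff_lt_or_eq.1 hi with hi' | rfl
    · rw [hfld _ (by omega) (by omega), hJ i hi']
    · exact hpt
  · rintro m₁ ⟨h01, hJ⟩
    have haddr : 8 + (r + r) = 8 + 2 * r := by ring
    have hbox : (fun i : Fin n => m₁.fld (8 + (m₁.num 2 + m₁.num 2) + i)) = fun i : Fin n =>
        genCoord e r (m.num 4) (m.num 3) (m.num 5) e i (m.num 7) := funext fun i => by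
      rw [h01.num 2 (by norm_num), ← hr', haddr, hJ i i.2]
    refine Runs.seq (T := 1) (T' := 1 + 1) (Runs.query (Runs.ite (fun h => Runs.nop ⟨?_, ?_⟩)
      fun h => Runs.setN ⟨?_, ?_⟩))
    · exact (h01.mono (by norm_num) le_rfl).setFld (by simp [NExp.val]; omega) _
    · simp only [Test.Holds, NExp.val, FExp.val, Mem.setFld_fld_self, hbox] at h
      rw [if_pos h]
      exact h01.num 8 (by norm_num)
    · exact ((h01.mono (by norm_num) le_rfl).setFld (by simp [NExp.val]; omega) _).setNum
        (by simp [NExp.val]) _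
    · simp only [Test.Holds, NExp.val, FExp.val, Mem.setFld_fld_self, hbox] at h
      rw [if_neg h]
      simp [NExp.val]
  · have h4 : 16 * W ^ 9 ≤ W ^ 10 := by
      rw [pow_succ W 9, mul_comm]; exact Nat.mul_le_mul_left _ hW
    have h1 : W ≤ W ^ 9 := Nat.le_self_pow (by norm_num) W
    calc _ ≤ W * (W ^ 8 + 3) + 3 + (1 + (1 + 1) + 1) + 1 := by gcongr
      _ = W ^ 9 + W * 3 + 8 := by ring
      _ ≤ W ^ 10 := by omega

end Seeds

/-! ### Computation of the parameters, and the search through all seeds -/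

section Main

open Prog

variable {F : Type*} [Field F] {n : ℕ} {e : ℕ → F} {box : (Fin n → F) → F}

/-- Cell `dst` is set to a power of the content of cell `base`. -/
def powNumProg (dst base : ℕ) (exponent : NExp) : Prog :=
  seq (setN (.const 17) (.const 1)) <|
  seq (Prog.for 16 exponent <| seq (setN (.const 19) (.const 0)) <|
    seq (Prog.for 18 (nc base) <| setN (.const 19) (.add (nc 19) (nc 17))) <|
    setN (.const 17) (nc 19)) <|
  setN (.const dst) (nc 17)

/-- Multiplication of numbers is not an instruction, so each product is a loop of additions; `N`
products with the factor `b` cost `O(W ^ 2)` steps. -/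
theorem runs_powNumProg {dst base W N : ℕ} {exponent : NExp} (hW : 16 ≤ W) (hbase : base < 16)
    (m : Mem F) (hexp : ∀ m' : Mem F, (∀ c < 16, m'.num c = m.num c) → exponent.val m' = N)
    (hb : m.num base ≤ W) (hN : N ≤ W) :
    Runs e box (powNumProg dst base exponent) (W ^ 3) m fun m' =>
      m'.num dst = m.num base ^ N ∧ ∀ c < 16, c ≠ dst → m'.num c = m.num c := by
  set b := m.num base with hb'
  refine (Runs.seq (T := 1) (T' := (N * ((1 + ((b * (1 + 3) + 3) + 1 + 1) + 1) + 3) + 3) + 1 + 1)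
    (Runs.setN ?_)).mono ?_
  · set m₁ := m.setNum ((NExp.const 17).val m) ((NExp.const 1).val m) with hm₁
    have h01 : ∀ c < 16, m₁.num c = m.num c := fun c hc =>
      Mem.setNum_num_of_ne _ _ (by simp only [NExp.val]; omega)
    refine Runs.seq (T := N * ((1 + ((b * (1 + 3) + 3) + 1 + 1) + 1) + 3) + 3) (T' := 1)
      ((Runs.for_frame (b := 0) (J := fun k m' => m'.num 17 = b ^ k) ?_ ?_ ?_
      ?_).imp ?_)
    · exact fun m' h => hexp m' fun c hc => (h c hc).trans (h01 c hc)
    · rintro k m' v h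
      rwa [Mem.setNum_num_of_ne _ _ (by norm_num)]
    · simp [hm₁, NExp.val]
    · rintro k hk m₂ h12 hk16 hJ
      refine Runs.seq (T := 1) (T' := (b * (1 + 3) + 3) + 1 + 1) (Runs.setN ?_)
      set m₃ := m₂.setNum ((NExp.const 19).val m₂) ((NExp.const 0).val m₂) with hm₃
      have h23 : Frame 18 0 m₂ m₃ := Frame.refl.setNum (by simp [NExp.val]) _
      refine Runs.seq (T := b * (1 + 3) + 3) (T' := 1)
        ((Runs.for_frame (b := 0) (J := fun j m' => m'.num 19 = j * b ^ k) ?_ ?_ ?_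
        ?_).imp ?_)
      · intro m' h
        simp only [NExp.val]
        rw [h _ (by omega), h23.num _ (by omega), h12.num _ hbase, h01 _ hbase]
      · rintro k m' v h
        rwa [Mem.setNum_num_of_ne _ _ (by norm_num)]
      · simp [hm₃, NExp.val]
      · rintro j hj m₄ h34 hj18 hJ'
        refine Runs.setN ⟨Frame.refl.setNum (by simp [NExp.val]) _, ?_⟩
        have : m₄.num 17 = b ^ k :=
          ((h23.trans h34).num 17 (by norm_num)).trans hJ
        simp only [NExp.val, Mem.setNum_num_self, hJ', this]
        ring
      · rintro m₄ ⟨h34, hJ'⟩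
        refine Runs.setN ⟨((h23.trans h34).mono (by norm_num) le_rfl).setNum
          (by simp [NExp.val]) _, ?_⟩
        simp only [NExp.val, Mem.setNum_num_self, hJ']
        ring
    · rintro m₂ ⟨h12, hJ⟩
      refine Runs.setN ⟨?_, fun c hc hne => ?_⟩
      · simp only [NExp.val, Mem.setNum_num_self, hJ]
      · simp only [NExp.val]
        rw [Mem.setNum_num_of_ne _ _ hne, h12.num c hc, h01 c hc]
  · have h4 : 16 * W ^ 2 ≤ W ^ 3 := by
      rw [pow_succ W 2, mul_comm]; exact Nat.mul_le_mul_left _ hW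
    have h5 : 16 * W ≤ W ^ 2 := by rw [sq]; exact Nat.mul_le_mul_right _ hW
    calc _ ≤ 1 + (W * ((1 + ((W * (1 + 3) + 3) + 1 + 1) + 1) + 3) + 3 + 1 + 1) + 1 := by gcongr
      _ = 4 * W ^ 2 + 10 * W + 7 := by ring
      _ ≤ W ^ 3 := by omega

/-- Cell `4` is set to `(d + 1) * r`. -/
def exponentProg : Prog :=
  seq (setN (.const 17) (.const 0)) <|
  seq (Prog.for 16 (.add (nc 1) (.const 1)) <| setN (.const 17) (.add (nc 17) (nc 2))) <|
  setN (.const 4) (nc 17)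

theorem runs_exponentProg (m : Mem F) :
    Runs e box exponentProg ((m.num 1 + 1) * 4 + 7) m fun m' =>
      m'.num 4 = (m.num 1 + 1) * m.num 2 ∧ ∀ c < 16, c ≠ 4 → m'.num c = m.num c := by
  refine (Runs.seq (T := 1) (T' := ((m.num 1 + 1) * (1 + 3) + 3) + 1 + 1)
    (Runs.setN ?_)).mono (by omega)
  set m₁ := m.setNum ((NExp.const 17).val m) ((NExp.const 0).val m) with hm₁
  have h01 : ∀ c < 16, m₁.num c = m.num c := fun c hc =>
    Mem.setNum_num_of_ne _ _ (by simp only [NExp.val]; omega)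
  refine Runs.seq (T := (m.num 1 + 1) * (1 + 3) + 3) (T' := 1)
    ((Runs.for_frame (b := 0) (J := fun k m' => m'.num 17 = k * m.num 2) ?_ ?_ ?_
    ?_).imp ?_)
  · intro m' h
    simp [NExp.val, h 1 (by norm_num), h01 1 (by norm_num)]
  · rintro k m' v h
    rwa [Mem.setNum_num_of_ne _ _ (by norm_num)]
  · simp [hm₁, NExp.val]
  · rintro k hk m₂ h12 hk16 hJ
    refine Runs.setN ⟨Frame.refl.setNum (by simp [NExp.val]) _, ?_⟩
    simp only [NExp.val, Mem.setNum_num_self, hJ, h12.num 2 (by norm_num), h01 2 (by norm_num)]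
    ring
  · rintro m₂ ⟨h12, hJ⟩
    refine Runs.setN ⟨?_, fun c hc hne => ?_⟩
    · simp only [NExp.val, Mem.setNum_num_self, hJ]
    · simp only [NExp.val]
      rw [Mem.setNum_num_of_ne _ _ hne, h12.num c hc, h01 c hc]

/-- Cell `5` is set to the rounded up binary logarithm of `n`. -/
def clogProg : Prog :=
  seq (setN (.const 5) (.const 0)) <| seq (setN (.const 9) (.const 1)) <|
  loop (.lt (nc 9) (nc 0)) <|
    seq (setN (.const 9) (.add (nc 9) (nc 9))) (setN (.const 5) (.add (nc 5) (.const 1)))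

/-- Doubling from `1` first reaches `n` after exactly `Nat.clog 2 n` rounds, also for `n = 0`. -/
theorem runs_clogProg (m : Mem F) :
    Runs e box clogProg (Nat.clog 2 (m.num 0) * 4 + 5) m fun m' =>
      m'.num 5 = Nat.clog 2 (m.num 0) ∧ ∀ c, c ≠ 5 → c ≠ 9 → m'.num c = m.num c := by
  refine (Runs.seq (T := 1) (T' := 1 + (Nat.clog 2 (m.num 0) * ((1 + 1 + 1) + 1) + 1) + 1)
    (Runs.setN (Runs.seq (Runs.setN ?_)))).mono (by omega)
  refine Runs.loop (I := fun k m' => m'.num 5 = k ∧ m'.num 9 = 2 ^ k ∧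
    ∀ c, c ≠ 5 → c ≠ 9 → m'.num c = m.num c) ⟨?_, ?_, fun c hc hc' => ?_⟩ ?_ ?_
  · simp [NExp.val, Mem.setNum_num_of_ne]
  · simp [NExp.val]
  · simp only [NExp.val]
    rw [Mem.setNum_num_of_ne _ _ hc', Mem.setNum_num_of_ne _ _ hc]
  · rintro k hk m₁ ⟨h5, h9, hn⟩
    refine ⟨?_, Runs.seq (Runs.setN (Runs.setN ⟨?_, ?_, fun c hc hc' => ?_⟩))⟩
    · simp only [Test.Holds, NExp.val, h9, hn 0 (by norm_num) (by norm_num)]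
      exact (Nat.lt_clog_iff_pow_lt one_lt_two).1 hk
    · simp [NExp.val, Mem.setNum_num_of_ne, h5]
    · simp [NExp.val, Mem.setNum_num_of_ne, h9, pow_succ, mul_two]
    · simp only [NExp.val]
      rw [Mem.setNum_num_of_ne _ _ hc, Mem.setNum_num_of_ne _ _ hc', hn c hc hc']
  · rintro m₁ ⟨h5, h9, hn⟩
    refine ⟨?_, h5, hn⟩
    simp only [Test.Holds, NExp.val, h9, hn 0 (by norm_num) (by norm_num), not_lt]
    exact Nat.le_pow_clog one_lt_two _

/-- The identity test. -/
def identityTest : Prog :=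
  seq (setN (.const 9) (.add (nc 0) (.add (nc 1) (.add (nc 2) (.const 2))))) <|
  seq (powNumProg 3 9 (.const 24)) <| seq exponentProg <| seq clogProg <|
  seq (powNumProg 6 3 (.add (nc 5) (.add (nc 5) (.const 1)))) <|
  seq (setN (.const 8) (.const 1)) <| seq (Prog.for 7 (nc 6) seedProg) <|
  setN (.const 0) (nc 8)

open Classical in
-- The number `W` of seeds bounds every parameter, so it can serve as the common bound in all
-- running times: `W` seeds at `W ^ 10` steps each, plus lower order terms.
theorem runs_identityTest {d r W : ℕ} (hW : ((n + d + r + 2) ^ 24) ^ (2 * Nat.clog 2 n + 1) = W)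
    (m : Mem F) (h0 : m.num 0 = n) (h1 : m.num 1 = d) (h2 : m.num 2 = r) :
    Runs e box identityTest (W ^ 12) m fun m' => m'.num 0 =
      if ∃ s < W, (box fun i => genCoord e r ((d + 1) * r) ((n + d + r + 2) ^ 24)
        (Nat.clog 2 n) e i s) ≠ 0 then 0 else 1 := by
  obtain ⟨X, hX⟩ : ∃ X, X = n + d + r + 2 := ⟨_, rfl⟩
  obtain ⟨K, hK⟩ : ∃ K, K = Nat.clog 2 n := ⟨_, rfl⟩
  obtain ⟨B, hB⟩ : ∃ B, B = X ^ 24 := ⟨_, rfl⟩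
  rw [← hX, ← hB, ← hK] at hW ⊢
  have hX2 : 2 ≤ X := by omega
  have hXB : X ^ 2 ≤ B := by rw [hB]; exact Nat.pow_le_pow_right (by omega) (by norm_num)
  have hXX : X ≤ X ^ 2 := Nat.le_self_pow (by norm_num) X
  have hB24 : 16777216 ≤ B := by
    rw [hB]
    calc 16777216 = 2 ^ 24 := by norm_num
      _ ≤ X ^ 24 := Nat.pow_le_pow_left hX2 24
  have hBW : B ≤ W := by rw [← hW]; exact Nat.le_self_pow (Nat.succ_ne_zero _) B
  have hKW : 2 * K + 1 ≤ W := by rw [← hW]; exact (Nat.lt_pow_self (by omega)).le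
  have hDW : (d + 1) * r ≤ W := by
    refine le_trans ?_ (hXB.trans hBW)
    rw [sq]
    exact Nat.mul_le_mul (by omega) (by omega)
  have hW16 : 16 ≤ W := by omega
  refine (Runs.seq (T := 1) (T' := W ^ 3 + ((d + 1) * 4 + 7 + (K * 4 + 5 + (W ^ 3 + (1 +
    ((W * (W ^ 10 + 3) + 3) + 1 + 1) + 1) + 1) + 1) + 1) + 1) (Runs.setN ?_)).mono ?_
  · set m₁ := m.setNum ((NExp.const 9).val m)
      ((NExp.add (nc 0) (.add (nc 1) (.add (nc 2) (.const 2)))).val m) with hm₁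
    have a9 : m₁.num 9 = X := by
      simp [hm₁, NExp.val, h0, h1, h2, hX, add_assoc]
    have a : ∀ c < 3, m₁.num c = m.num c := fun c hc =>
      Mem.setNum_num_of_ne _ _ (by simp only [NExp.val]; omega)
    refine Runs.seq ((runs_powNumProg (N := 24) hW16 (by norm_num) m₁ (fun _ _ => rfl)
      (by omega) (by omega)).imp ?_)
    rintro m₂ ⟨b3, b⟩
    rw [a9, ← hB] at b3
    have b1 : m₂.num 1 = d := by rw [b 1 (by norm_num) (by norm_num), a 1 (by norm_num), h1]
    have b2 : m₂.num 2 = r := by rw [b 2 (by norm_num) (by norm_num), a 2 (by norm_num), h2]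
    have b0 : m₂.num 0 = n := by rw [b 0 (by norm_num) (by norm_num), a 0 (by norm_num), h0]
    refine Runs.seq (T := (d + 1) * 4 + 7) (((runs_exponentProg m₂).mono (by rw [b1])).imp ?_)
    rintro m₃ ⟨c4, c⟩
    have c0 : m₃.num 0 = n := by rw [c 0 (by norm_num) (by norm_num), b0]
    refine Runs.seq (T := K * 4 + 5) (((runs_clogProg m₃).mono (by rw [c0, hK])).imp ?_)
    rintro m₄ ⟨d5, d'⟩
    rw [c0, ← hK] at d5
    have d3 : m₄.num 3 = B := by
      rw [d' 3 (by norm_num) (by norm_num), c 3 (by norm_num) (by norm_num), b3]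
    refine Runs.seq ((runs_powNumProg (N := 2 * K + 1) hW16 (by norm_num) m₄ (fun m' h => ?_)
      (by omega) hKW).imp ?_)
    · simp only [NExp.val, h 5 (by norm_num), d5]
      omega
    rintro m₅ ⟨e6, e'⟩
    rw [d3, hW] at e6
    refine Runs.seq (Runs.setN ?_)
    set m₆ := m₅.setNum ((NExp.const 8).val m₅) ((NExp.const 1).val m₅) with hm₆
    have f' : ∀ c < 7, m₆.num c = m₅.num c := fun c hc =>
      Mem.setNum_num_of_ne _ _ (by simp only [NExp.val]; omega)
    have f8 : m₆.num 8 = 1 := by simp [hm₆, NExp.val]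
    have f6 : m₆.num 6 = W := (f' 6 (by norm_num)).trans e6
    have f0 : m₆.num 0 = n := by
      rw [f' 0 (by norm_num), e' 0 (by norm_num) (by norm_num), d' 0 (by norm_num) (by norm_num),
        c0]
    have f2 : m₆.num 2 = r := by
      rw [f' 2 (by norm_num), e' 2 (by norm_num) (by norm_num), d' 2 (by norm_num) (by norm_num),
        c 2 (by norm_num) (by norm_num), b2]
    have f3 : m₆.num 3 = B := by
      rw [f' 3 (by norm_num), e' 3 (by norm_num) (by norm_num), d3]
    have f4 : m₆.num 4 = (d + 1) * r := by
      rw [f' 4 (by norm_num), e' 4 (by norm_num) (by norm_num), d' 4 (by norm_num) (by norm_num),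
        c4, b1, b2]
    have f5 : m₆.num 5 = K := by
      rw [f' 5 (by norm_num), e' 5 (by norm_num) (by norm_num), d5]
    refine Runs.seq (T := W * (W ^ 10 + 3) + 3) (T' := 1)
      ((Runs.for_frame (b := 8 + 2 * r + n) (J := fun k m' => m'.num 8 =
      if ∃ s < k, (box fun i => genCoord e r ((d + 1) * r) B K e i s) ≠ 0 then 0 else 1)
      ?_ ?_ ?_ ?_).imp ?_)
    · intro m' h
      simp [NExp.val, h 6 (by norm_num), f6]
    · rintro k m' v h
      rwa [Mem.setNum_num_of_ne _ _ (by norm_num)]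
    · simp [f8]
    · rintro k hk m₇ h67 hk7 hJ
      have g2 := (h67.num 2 (by norm_num)).trans f2
      have g3 := (h67.num 3 (by norm_num)).trans f3
      have g4 := (h67.num 4 (by norm_num)).trans f4
      have g5 := (h67.num 5 (by norm_num)).trans f5
      refine (runs_seedProg hW16 m₇ ((h67.num 0 (by norm_num)).trans f0) (by omega) (by omega)
        (by omega) (by omega) (by omega) (by omega)).imp ?_
      rintro m₈ ⟨h78, h8⟩
      rw [g2] at h78
      refine ⟨h78, ?_⟩
      rw [h8, g2, g3, g4, g5, hk7, hJ]
      by_cases hex : ∃ s < k, (box fun i => genCoord e r ((d + 1) * r) B K e i s) ≠ 0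
      · have hex' : ∃ s < k + 1, (box fun i => genCoord e r ((d + 1) * r) B K e i s) ≠ 0 := by
          obtain ⟨s, hs, hne⟩ := hex
          exact ⟨s, hs.trans (Nat.lt_succ_self k), hne⟩
        rw [if_pos hex, if_pos hex', ite_self]
      · rw [if_neg hex]
        by_cases hz : (box fun i => genCoord e r ((d + 1) * r) B K e i k) = 0
        · rw [if_pos hz, if_neg]
          rintro ⟨s, hs, hne⟩
          rcases Nat.lt_succ_iff_lt_or_eq.1 hs with hs' | rfl
          · exact hex ⟨s, hs', hne⟩
          · exact hne hz
        · rw [if_neg hz, if_pos ⟨k, Nat.lt_succ_self k, hz⟩]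
    · rintro m₇ ⟨-, hJ⟩
      refine Runs.setN ?_
      simp only [NExp.val, Mem.setNum_num_self]
      exact hJ
  · have h11 : 16 * W ^ 11 ≤ W ^ 12 := by
      rw [pow_succ W 11, mul_comm]; exact Nat.mul_le_mul_left _ hW16
    have h1' : W ≤ W ^ 11 := Nat.le_self_pow (by norm_num) W
    have h3 : W ^ 3 ≤ W ^ 11 := Nat.pow_le_pow_right (by omega) (by norm_num)
    have hd : d + 1 ≤ W := by omega
    have hK' : K * 4 ≤ W * 2 := by omega
    have e1 : W * (W ^ 10 + 3) = W ^ 11 + W * 3 := by ring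
    rw [e1]
    omega

theorem TestsZeroWithin.of_runs {P : Prog} {d r T : ℕ} {f : MvPolynomial (Fin n) F}
    (h : Runs e (fun x : Fin n → F => MvPolynomial.eval x f) P T (start P n d r : Config F).mem
      fun m' => (f = 0 → m'.num 0 = 1) ∧ (f ≠ 0 → m'.num 0 = 0)) :
    TestsZeroWithin P e d r f T := by
  obtain ⟨t, ht, m', hm', h⟩ := h
  exact ⟨t, ht, m', h [], hm'⟩

end Main

end BlackBoxPIT

/-- A single program, the same for all fields, decides from black-box access whether an `n`-variate
polynomial of degree at most `d` and evaluation dimension at most `r` is zero, in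
`poly(n, d, r) ^ O(lg n)` steps. -/
theorem mainTheorem11 :
    ∃ (P : BlackBoxPIT.Prog) (c : ℕ),
      ∀ (F : Type*) [Field F] (e : ℕ → F), BlackBoxPIT.IsEnumeration e →
        ∀ n d r : ℕ, (((2 * n * (d + 1) ^ 7 * r ^ 3) ^ 2 : ℕ) : ℕ∞) ≤ ENat.card F →
          ∀ f : MvPolynomial (Fin n) F, f.totalDegree ≤ d → BlackBoxPIT.EvalDimLE f r →
            BlackBoxPIT.TestsZeroWithin P e d r f
              ((n + d + r + 2) ^ (c * (Nat.clog 2 n + 1))) := by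
  classical
  -- `W ^ 12` is the power of `n + d + r + 2` with exponent `24 * (2 * Nat.clog 2 n + 1) * 12`, and
  -- `576 = 24 * 2 * 12`.
  refine ⟨BlackBoxPIT.identityTest, 576, fun F _ e he n d r hF f hd hf => ?_⟩
  refine BlackBoxPIT.TestsZeroWithin.of_runs ((BlackBoxPIT.runs_identityTest (n := n) (d := d)
    (r := r) rfl _ rfl rfl rfl).weaken ?_ fun m' hm' => ⟨fun h => ?_, fun h => ?_⟩)
  · rw [← pow_mul, ← pow_mul]
    exact Nat.pow_le_pow_right (by omega) (by omega)
  · rw [hm', if_neg]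
    rintro ⟨s, -, hs⟩
    exact hs (by rw [h, map_zero])
  · rw [hm', if_pos]
    exact BlackBoxPIT.exists_genCoord_ne_zero he hF hd hf h
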